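/- Let $G$ be a finite group and $F$ a number field, regarded as a subfield of $\mathbb{C}$; put $\zeta_k=e^{2\pi i/k}$ and $\alpha^g=g^{-1}\alpha g$. **Notation.** For $N\unlhd B$ (with $B$ a finite group) let $\widehat N=\frac1{|N|}\sum_{n\in N}n$ and $\varepsilon(B,N)=\widehat N\prod_{M}(1-\widehat M)\in\mathbb{Q}B$, where $M/N$ runs over the minimal nontrivial normal subgroups of $B/N$ (so $\varepsilon(B,B)=\widehat B$). For $K\unlhd H\le G$ with $H/K$ cyclic of order $k$: * $\mathcal{C}_F(H/K)$ is the set of orbits of the faithful characters $\chi:H/K\to F(\zeta_k)^\times$ under $\mathrm{Gal}(F(\zeta_k)/F)$; * for $\chi\in C\in\mathcal{C}_F(H/K)$, $\varepsilon_C(H,K)=\frac1{|H|}\sum_{h\in H}\mathrm{tr}_{F(\zeta_k)/F}(\chi(hK))\,h^{-1}\in FH$ (independent of the choice of $\chi\in C$); * $e(G,H,K)$ and $e_C(G,H,K)$ are the sums of the different $G$-conjugates of $\varepsilon(H,K)$ in $\mathbb{Q}G$ and of $\varepsilon_C(H,K)$ in $FG$, respectively; * $I_k(F)\le(\mathbb{Z}/k\mathbb{Z})^\times$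 is the group of all $t$ such that $\zeta_k\mapsto\zeta_k^t$ for some element of $\mathrm{Gal}(F(\zeta_k)/F)$; * $E_F(G,H/K)$ is the group of all $g\in N_G(H)\cap N_G(K)$ for which there is $t\in I_k(F)$ with $g^{-1}hgK=h^tK$ for all $h\in H$. It is the stabilizer of every $C\in\mathcal{C}_F(H/K)$ and contains $H$. A pair $(H,K)$ of subgroups of $G$ is a *strong Shoda pair* if $K\le H\unlhd N_G(K)$, $H/K$ is cyclic and a maximal abelian subgroup of $N_G(K)/K$, and $\varepsilon(H,K)\,\varepsilon(H,K)^g=0$ for every $g\in G\setminus N_G(K)$. The crossed product $L*^\sigma_\tau\Gamma=\bigoplus_{g\in\Gamma}u_gL$ has multiplication determined by $r\,u_g=u_g\,\sigma_g(r)$ for $r\in L$ and $u_gu_{g'}=u_{gg'}\,\tau(g,g')$. A *primitive central idempotent* is a nonzero central idempotent that is not the sum of two nonzero orthogonal central idempotents. **Theorem.** 1. Let $(H,K)$ be a strong Shoda pair of $G$, $C\in\mathcal{C}_F(H/K)$, $k=[H:K]$ and $E=E_F(G,H/K)$. Then $e_C(G,H,K)$ is a primitive central idempotent of $FG$. Moreover,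 let $\phi:E/H\to E/K$ be any section of the projection $E/K\to E/H$, let $\chi\in C$, and let $y$ be the generator of $H/K$ with $\chi(y)=\zeta_k$. Then there are well-defined maps $\sigma:E/H\to\mathrm{Gal}(F(\zeta_k)/F)$ and $\tau:E/H\times E/H\to F(\zeta_k)^\times$ given by $$\sigma_{a}(\zeta_k)=\zeta_k^{\,i}\ \text{ if }\ \phi(a)^{-1}\,y\,\phi(a)=y^i,\qquad \tau(a,b)=\zeta_k^{\,j}\ \text{ if }\ \phi(ab)^{-1}\phi(a)\phi(b)=y^j$$ for $a,b\in E/H$ (such integers $i,j$ always exist). They make $F(\zeta_k)*^\sigma_\tau E/H$ an associative unital $F$-algebra, and there is an isomorphism of $F$-algebras $$FG\,e_C(G,H,K)\;\cong\;M_{[G:E]}\bigl(F(\zeta_k)*^\sigma_\tau E/H\bigr).$$ 2. Let $X$ be a set of strong Shoda pairs of $G$. If every primitive central idempotent of $\mathbb{Q}G$ is of the form $e(G,H,K)$ with $(H,K)\in X$, then every primitive central idempotent of $FG$ is of the form $e_C(G,H,K)$ with $(H,K)\in X$ and $C\in\mathcal{C}_F(H/K)$. -/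

import Mathlib

open scoped IntermediateField

noncomputable section

namespace GroupAlgebraIdempotents

/-! ### Idempotents, conjugation and blocks -/

section Idempotents

/-- A primitive central idempotent of a ring: a nonzero central idempotent which is not the sum of
two nonzero orthogonal central idempotents. -/
structure IsPrimitiveCentralIdempotent {A : Type*} [Ring A] (e : A) : Prop where
  idem : IsIdempotentElem e
  central : e ∈ Subring.center A
  ne_zero : e ≠ 0
  primitive : ∀ e₁ e₂ : A, IsIdempotentElem e₁ → IsIdempotentElem e₂ →
    e₁ ∈ Subring.center A → e₂ ∈ Subring.center A → e₁ * e₂ = 0 → e = e₁ + e₂ →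
    e₁ = 0 ∨ e₂ = 0

/-- The (in general non-unital) subalgebra `A e` of an algebra `A`. When `e` is a central
idempotent it is a two-sided ideal, and an algebra with identity element `e`. -/
def block (F : Type*) {A : Type*} [Field F] [Ring A] [Algebra F A] (e : A) :
    NonUnitalSubalgebra F A where
  carrier := {x | ∃ a : A, x = a * e}
  zero_mem' := ⟨0, by simp⟩
  add_mem' := by
    rintro _ _ ⟨a, rfl⟩ ⟨b, rfl⟩
    exact ⟨a + b, by rw [add_mul]⟩
  mul_mem' := by
    rintro _ _ ⟨a, rfl⟩ ⟨b, rfl⟩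
    exact ⟨a * e * b, by simp only [mul_assoc]⟩
  smul_mem' := by
    rintro c _ ⟨a, rfl⟩
    exact ⟨c • a, by rw [smul_mul_assoc]⟩

variable {R G : Type*} [Ring R] [Group G]

/-- The conjugate `α ^ g = g⁻¹ α g` of an element `α` of the group ring `R G`. -/
def conj (α : MonoidAlgebra R G) (g : G) : MonoidAlgebra R G :=
  MonoidAlgebra.single g⁻¹ 1 * α * MonoidAlgebra.single g 1

/-- The sum of the different `G`-conjugates of an element of the group ring (`G` finite). -/
def sumConj (α : MonoidAlgebra R G) : MonoidAlgebra R G :=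
  ∑ᶠ β ∈ Set.range (conj α), β

end Idempotents

/-! ### The rational idempotents `ε(G, N)` -/

section Rational

variable {G : Type*} [Group G]

/-- `N̂ = |N|⁻¹ ∑_{n ∈ N} n` in `ℚ G`. -/
def hat (N : Subgroup G) : MonoidAlgebra ℚ G :=
  (Nat.card N : ℚ)⁻¹ • ∑ᶠ n : N, MonoidAlgebra.single (n : G) (1 : ℚ)

theorem hat_mem_center [Finite G] (N : Subgroup G) (hN : N.Normal) :
    hat N ∈ Subring.center (MonoidAlgebra ℚ G) := by
  classical
  have := Fintype.ofFinite N
  have key : ∀ g : G, Commute (hat N) (MonoidAlgebra.single g (1 : ℚ)) := by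
    intro g
    rw [hat, finsum_eq_sum_of_fintype]
    refine Commute.smul_left ?_ _
    rw [Commute, SemiconjBy, Finset.sum_mul, Finset.mul_sum]
    refine Fintype.sum_equiv (MulAut.conjNormal g⁻¹ : N ≃* N).toEquiv _ _ ?_
    intro n
    simp [MonoidAlgebra.single_mul_single, mul_assoc]
  rw [Subring.mem_center_iff]
  intro x
  induction x using MonoidAlgebra.induction_on with
  | of g => exact (key g).symm.eq
  | add x y hx hy => rw [add_mul, mul_add, hx, hy]
  | smul r x hx => rw [smul_mul_assoc, mul_smul_comm, hx]

/-- `N̂`, for a normal subgroup `N`, as an element of the centre of `ℚ G`. -/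
def hatCenter [Finite G] (N : Subgroup G) (hN : N.Normal) :
    Subring.center (MonoidAlgebra ℚ G) :=
  ⟨hat N, hat_mem_center N hN⟩

/-- `ε(G, N) = N̂ ∏_M (1 - M̂)`, where `M / N` runs over the minimal nontrivial normal subgroups
of `G / N`. For `N = G` the product is empty and `ε(G, G) = Ĝ`. The product is formed in the centre
of `ℚ G`, where all its factors lie. -/
def eps [Finite G] (N : Subgroup G) [hN : N.Normal] : MonoidAlgebra ℚ G :=
  ((hatCenter N hN *
    ∏ᶠ M : {M : Subgroup (G ⧸ N) // Minimal (fun S => S.Normal ∧ S ≠ ⊥) M},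
      (1 - hatCenter (M.1.comap (QuotientGroup.mk' N)) (M.2.prop.1.comap _)) :
        Subring.center (MonoidAlgebra ℚ G)) : MonoidAlgebra ℚ G)

end Rational

/-! ### Cyclotomic extensions and faithful characters of cyclic groups -/

section Characters

variable (F : Type*) [Field F] [Algebra F ℂ]

/-- The complex root of unity `exp (2 π i / k)`. -/
def zetaC (k : ℕ) : ℂ := Complex.exp (2 * Real.pi * Complex.I / k)

/-- The field `F(ζ_k)`, inside `ℂ`. -/
abbrev CycloField (k : ℕ) : IntermediateField F ℂ := F⟮zetaC k⟯

/-- `ζ_k` as an element of `F(ζ_k)`. -/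
def zeta (k : ℕ) : CycloField F k := IntermediateField.AdjoinSimple.gen F (zetaC k)

theorem zeta_isPrimitiveRoot (k : ℕ) [NeZero k] : IsPrimitiveRoot (zeta F k) k := by
  have h : IsPrimitiveRoot (zetaC k) k := Complex.isPrimitiveRoot_exp k (NeZero.ne k)
  refine IsPrimitiveRoot.of_map_of_injective (f := (CycloField F k).val) ?_
    (CycloField F k).val.injective
  exact h

/-- `I_k(F)`: the group of the `t` modulo `k` such that `ζ_k ↦ ζ_k ^ t` for some element of
`Gal(F(ζ_k) / F)`. -/
def unitsI (k : ℕ) [NeZero k] : Subgroup (ZMod k)ˣ :=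
  ((zeta_isPrimitiveRoot F k).autToPow F).range

/-- The faithful linear characters of a group `Q` with `k` elements. All values of such a character
are `k`-th roots of unity, so they lie in `F(ζ_k)`. -/
def FaithfulChar (Q : Type*) [Group Q] : Type _ :=
  {χ : Q →* CycloField F (Nat.card Q) // Function.Injective χ}

/-- Two faithful characters are equivalent when they lie in the same orbit under the action
`(σ, χ) ↦ σ ∘ χ` of `Gal(F(ζ_k) / F)`. -/
instance faithfulCharSetoid (Q : Type*) [Group Q] : Setoid (FaithfulChar F Q) where
  r χ ψ := ∃ s : CycloField F (Nat.card Q) ≃ₐ[F] CycloField F (Nat.card Q),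
    ∀ q : Q, ψ.1 q = s (χ.1 q)
  iseqv :=
    { refl := fun _ => ⟨AlgEquiv.refl, fun _ => rfl⟩
      symm := by
        rintro _ _ ⟨s, hs⟩
        exact ⟨s.symm, fun q => by rw [hs q, AlgEquiv.symm_apply_apply]⟩
      trans := by
        rintro _ _ _ ⟨s, hs⟩ ⟨t, ht⟩
        exact ⟨s.trans t, fun q => by rw [ht q, hs q, AlgEquiv.trans_apply]⟩ }

/-- `𝒞_F(Q)`: the orbits of the faithful characters of the cyclic group `Q`. -/
def CharClass (Q : Type*) [Group Q] : Type _ := Quotient (faithfulCharSetoid F Q)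

end Characters

/-! ### Pairs of subgroups -/

/-- Subgroups `K ⊴ H ≤ G` such that `H / K` is cyclic. -/
structure CyclicSection (G : Type*) [Group G] where
  /-- the subgroup `H` -/
  H : Subgroup G
  /-- the subgroup `K` -/
  K : Subgroup G
  K_le_H : K ≤ H
  [normal : (K.subgroupOf H).Normal]
  cyclic : IsCyclic (H ⧸ K.subgroupOf H)

attribute [instance] CyclicSection.normal CyclicSection.cyclic

namespace CyclicSection

variable {G : Type*} [Group G]

/-- The group `H / K`. -/
abbrev Q (P : CyclicSection G) : Type _ := P.H ⧸ P.K.subgroupOf P.H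

/-- `k = [H : K]`. -/
def k (P : CyclicSection G) : ℕ := Nat.card P.Q

instance [Finite G] (P : CyclicSection G) : NeZero P.k :=
  ⟨Nat.card_pos.ne'⟩

/-- `ε(H, K)`, an element of `ℚ H ⊆ ℚ G`. -/
def eps [Finite G] (P : CyclicSection G) : MonoidAlgebra ℚ G :=
  MonoidAlgebra.mapDomainRingHom ℚ P.H.subtype
    (GroupAlgebraIdempotents.eps (P.K.subgroupOf P.H))

/-- `e(G, H, K)`: the sum of the different `G`-conjugates of `ε(H, K)`. -/
def e [Finite G] (P : CyclicSection G) : MonoidAlgebra ℚ G := sumConj P.eps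

section Field

variable (F : Type*) [Field F] [Algebra F ℂ]

/-- `|H|⁻¹ ∑_{h ∈ H} tr(χ(hK)) h⁻¹`, an element of `F H ⊆ F G`, where `tr` is the trace of
`F(ζ_k) / F`. -/
def epsChar (P : CyclicSection G) (χ : FaithfulChar F P.Q) : MonoidAlgebra F G :=
  (Nat.card P.H : F)⁻¹ • ∑ᶠ h : P.H,
    MonoidAlgebra.single (h : G)⁻¹
      (Algebra.trace F (CycloField F (Nat.card P.Q)) (χ.1 (QuotientGroup.mk h)))

theorem epsChar_eq (P : CyclicSection G) (χ ψ : FaithfulChar F P.Q) (h : χ ≈ ψ) :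
    epsChar F P χ = epsChar F P ψ := by
  obtain ⟨s, hs⟩ := h
  simp only [epsChar, hs, Algebra.trace_eq_of_algEquiv]

variable {F}

/-- `ε_C(H, K)`: the common value of `epsChar` on the characters in `C`. -/
def epsC (P : CyclicSection G) (C : CharClass F P.Q) : MonoidAlgebra F G :=
  Quotient.lift (epsChar F P) (epsChar_eq F P) C

/-- `e_C(G, H, K)`: the sum of the different `G`-conjugates of `ε_C(H, K)`. -/
def eC (P : CyclicSection G) (C : CharClass F P.Q) : MonoidAlgebra F G := sumConj (P.epsC C)

variable (F)

/-- `g` acts by conjugation on `H / K` as raising to the power `t`. -/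
def ActsAsPow (P : CyclicSection G) (g : G) (t : ℕ) : Prop :=
  ∀ h h' : P.H, (h' : G) = g⁻¹ * h * g →
    (QuotientGroup.mk h' : P.Q) = (QuotientGroup.mk h : P.Q) ^ t

/-- `E_F(G, H/K)`: the elements `g` of `N_G(H) ∩ N_G(K)` for which there is `t ∈ I_k(F)` with
`g⁻¹ h g K = h ^ t K` for all `h ∈ H`, that is, those with `χ ^ g = χ ^ t` for the faithful
characters `χ` of `H / K`. It is the stabilizer in `N_G(H) ∩ N_G(K)` of any `C ∈ 𝒞_F(H/K)`. -/
def E [Finite G] (P : CyclicSection G) : Subgroup G where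
  carrier := {g | g ∈ Subgroup.normalizer (P.H : Set G) ∧ g ∈ Subgroup.normalizer (P.K : Set G) ∧
    ∃ t ∈ unitsI F P.k, P.ActsAsPow g (t : ZMod P.k).val}
  one_mem' := by
    refine ⟨one_mem _, one_mem _, 1, one_mem _, ?_⟩
    intro h h' hh
    obtain rfl : h' = h := Subtype.ext (by simpa using hh)
    rw [Units.val_one, ZMod.val_one_eq_one_mod]
    change _ = _ ^ (1 % Nat.card P.Q)
    rw [pow_mod_natCard, pow_one]
  mul_mem' := by
    rintro a b ⟨ha, ha', s, hs, has⟩ ⟨hb, hb', t, ht, hbt⟩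
    refine ⟨mul_mem ha hb, mul_mem ha' hb', s * t, mul_mem hs ht, ?_⟩
    intro h h' hh
    have hm : a⁻¹ * (h : G) * a ∈ P.H :=
      (Subgroup.mem_normalizer_iff''.mp ha (h : G)).mp h.2
    rw [hbt ⟨_, hm⟩ h' (by rw [hh]; group), has h ⟨_, hm⟩ rfl, ← pow_mul, Units.val_mul,
      ZMod.val_mul]
    change _ = _ ^ (_ % Nat.card P.Q)
    rw [pow_mod_natCard]
  inv_mem' := by
    rintro a ⟨ha, ha', s, hs, has⟩
    refine ⟨inv_mem ha, inv_mem ha', s⁻¹, inv_mem hs, ?_⟩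
    intro h h' hh
    have key := has h' h (by rw [hh]; group)
    rw [key, ← pow_mul]
    have h1 : ((s : ZMod P.k).val * ((s⁻¹ : (ZMod P.k)ˣ) : ZMod P.k).val) % Nat.card P.Q
        = 1 % Nat.card P.Q := by
      change _ % P.k = 1 % P.k
      rw [← ZMod.val_mul, Units.mul_inv, ZMod.val_one_eq_one_mod]
    rw [← pow_mod_natCard, h1, pow_mod_natCard, pow_one]

variable [Finite G] (P : CyclicSection G)

theorem H_le_E : P.H ≤ P.E F := by
  intro g hg
  have : IsMulCommutative P.Q := IsCyclic.isMulCommutative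
  refine ⟨Subgroup.le_normalizer hg, ?_, 1, one_mem _, ?_⟩
  · have := (Subgroup.normal_subgroupOf_iff_le_normalizer P.K_le_H).mp P.normal
    exact this hg
  · intro h h' hh
    have : h' = (⟨g, hg⟩ : P.H)⁻¹ * h * ⟨g, hg⟩ := Subtype.ext (by simpa using hh)
    rw [this, Units.val_one, ZMod.val_one_eq_one_mod]
    change _ = _ ^ (1 % Nat.card P.Q)
    rw [pow_mod_natCard, pow_one, QuotientGroup.mk_mul, QuotientGroup.mk_mul,
      QuotientGroup.mk_inv, mul_comm' _ (QuotientGroup.mk h : P.Q), mul_assoc, inv_mul_cancel,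
      mul_one]

theorem K_le_E : P.K ≤ P.E F := P.K_le_H.trans (P.H_le_E F)

instance : (P.H.subgroupOf (P.E F)).Normal :=
  (Subgroup.normal_subgroupOf_iff_le_normalizer (P.H_le_E F)).mpr fun _ hg => hg.1

instance : (P.K.subgroupOf (P.E F)).Normal :=
  (Subgroup.normal_subgroupOf_iff_le_normalizer (P.K_le_E F)).mpr fun _ hg => hg.2.1

/-- The group `E / H`. -/
abbrev EmodH : Type _ := P.E F ⧸ P.H.subgroupOf (P.E F)

/-- The group `E / K`. -/
abbrev EmodK : Type _ := P.E F ⧸ P.K.subgroupOf (P.E F)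

/-- The projection `E / K → E / H`. -/
def proj : P.EmodK F →* P.EmodH F :=
  QuotientGroup.map _ _ (MonoidHom.id _) fun _ hx => P.K_le_H hx

/-- The inclusion `H / K → E / K`. -/
def incl : P.Q →* P.EmodK F :=
  QuotientGroup.map _ _ (Subgroup.inclusion (P.H_le_E F)) fun _ hx => hx

end Field

end CyclicSection

/-- Strong Shoda pairs `(H, K)` of a finite group `G`. -/
structure StrongShodaPair (G : Type*) [Group G] [Finite G] extends CyclicSection G where
  H_le_normalizer : H ≤ Subgroup.normalizer (K : Set G)
  H_normal : (H.subgroupOf (Subgroup.normalizer (K : Set G))).Normal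
  /-- `H / K` is a maximal abelian subgroup of `N_G(K) / K`. -/
  maximal_abelian :
    Maximal
      (fun A : Subgroup (Subgroup.normalizer (K : Set G) ⧸
        K.subgroupOf (Subgroup.normalizer (K : Set G))) => IsMulCommutative A)
      ((H.subgroupOf (Subgroup.normalizer (K : Set G))).map (QuotientGroup.mk' _))
  eps_mul_conj : ∀ g : G, g ∉ Subgroup.normalizer (K : Set G) →
    toCyclicSection.eps * conj toCyclicSection.eps g = 0

/-! ### Crossed products -/

/-- An action `σ` and a twisting `τ` of a group `Γ` on a commutative `F`-algebra `L`, compatible in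
the way that makes the crossed product `L *_τ^σ Γ = ⨁_g u_g L` with
`r u_g = u_g σ_g(r)` and `u_g u_h = u_{gh} τ(g, h)` associative. -/
structure CrossedSystem (F L Γ : Type*) [Field F] [CommRing L] [Algebra F L] [Group Γ] where
  /-- the action -/
  σ : Γ → (L ≃ₐ[F] L)
  /-- the twisting -/
  τ : Γ → Γ → Lˣ
  action : ∀ a b r, σ b (σ a r) = σ (a * b) r
  cocycle : ∀ a b c, (τ (a * b) c : L) * σ c (τ a b) = τ a (b * c) * τ b c

/-- The crossed product `L *_τ^σ Γ`: its elements are the formal sums `∑_g u_g r_g` with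
coefficients `r_g` in `L`, where `Finsupp.single g r` stands for `u_g r`. -/
def CrossedProduct {F L Γ : Type*} [Field F] [CommRing L] [Algebra F L] [Group Γ]
    (_S : CrossedSystem F L Γ) : Type _ := Γ →₀ L

namespace CrossedProduct

variable {F L Γ : Type*} [Field F] [CommRing L] [Algebra F L] [Group Γ] (S : CrossedSystem F L Γ)

instance : AddCommGroup (CrossedProduct S) := inferInstanceAs (AddCommGroup (Γ →₀ L))

instance : Module F (CrossedProduct S) := inferInstanceAs (Module F (Γ →₀ L))

/-- The element `u_g r`. -/
def single (g : Γ) (r : L) : CrossedProduct S := Finsupp.single g r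

theorem single_zero (g : Γ) : single S g 0 = 0 := Finsupp.single_zero g

theorem single_add (g : Γ) (r s : L) : single S g (r + s) = single S g r + single S g s :=
  Finsupp.single_add g r s

theorem smul_single (c : F) (g : Γ) (r : L) : c • single S g r = single S g (c • r) :=
  Finsupp.smul_single c g r

/-- The multiplication, `(u_a r) (u_b s) = u_{ab} τ(a, b) σ_b(r) s`, extended biadditively. -/
instance : Mul (CrossedProduct S) :=
  ⟨fun x y => Finsupp.sum x fun a r => Finsupp.sum y fun b s =>
    single S (a * b) (S.τ a b * S.σ b r * s)⟩

theorem mul_def (x y : CrossedProduct S) :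
    x * y = Finsupp.sum x fun a r => Finsupp.sum y fun b s =>
      single S (a * b) (S.τ a b * S.σ b r * s) := rfl

theorem single_mul_single (a b : Γ) (r s : L) :
    single S a r * single S b s = single S (a * b) (S.τ a b * S.σ b r * s) := by
  rw [mul_def, single, Finsupp.sum_single_index, single, Finsupp.sum_single_index]
  · rw [mul_zero, single_zero]
  · refine Finset.sum_eq_zero fun b _ => ?_
    simp only [map_zero, mul_zero, zero_mul, single_zero]

theorem induction {p : CrossedProduct S → Prop} (x : CrossedProduct S)
    (h0 : p 0) (hadd : ∀ x y, p x → p y → p (x + y)) (hs : ∀ g r, p (single S g r)) : p x :=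
  Finsupp.induction_linear x h0 hadd hs

theorem tau_one_left (b : Γ) : (S.τ 1 b : L) = S.σ b (S.τ 1 1) := by
  have h := S.cocycle 1 1 b
  rw [one_mul, one_mul] at h
  exact ((S.τ 1 b).isUnit.mul_left_cancel h).symm

theorem sigma_one (r : L) : S.σ 1 r = r := by
  have h := S.action 1 1 r
  rw [one_mul] at h
  exact (S.σ 1).injective h

theorem tau_one_right (a : Γ) : (S.τ a 1 : L) = S.τ 1 1 := by
  have h := S.cocycle a 1 1
  rw [mul_one, mul_one, sigma_one] at h
  exact (S.τ a 1).isUnit.mul_left_cancel h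

instance : One (CrossedProduct S) := ⟨single S 1 ((S.τ 1 1)⁻¹ : Lˣ)⟩

theorem one_def : (1 : CrossedProduct S) = single S 1 ((S.τ 1 1)⁻¹ : Lˣ) := rfl

theorem add_mul_aux (x y z : CrossedProduct S) : (x + y) * z = x * z + y * z := by
  refine Finsupp.sum_add_index' (fun a => ?_) (fun a r s => ?_)
  · refine Finset.sum_eq_zero fun b _ => ?_
    simp only [map_zero, mul_zero, zero_mul, single_zero]
  · simp only [map_add, mul_add, add_mul, single_add]
    exact Finset.sum_add_distrib

theorem mul_add_aux (x y z : CrossedProduct S) : x * (y + z) = x * y + x * z := by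
  simp only [mul_def]
  refine Eq.trans (Finset.sum_congr rfl fun a _ => ?_) Finset.sum_add_distrib
  refine Finsupp.sum_add_index' (fun b => ?_) (fun b r s => ?_)
  · rw [mul_zero, single_zero]
  · rw [mul_add, single_add]

theorem zero_mul_aux (x : CrossedProduct S) : 0 * x = 0 := Finsupp.sum_zero_index

theorem mul_zero_aux (x : CrossedProduct S) : x * 0 = 0 :=
  Finset.sum_eq_zero fun _ _ => Finsupp.sum_zero_index

theorem mul_assoc_aux (x y z : CrossedProduct S) : x * y * z = x * (y * z) := by
  induction x using induction with
  | h0 => simp only [zero_mul_aux]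
  | hadd x x' hx hx' => simp only [add_mul_aux, hx, hx']
  | hs a r =>
    induction y using induction with
    | h0 => simp only [zero_mul_aux, mul_zero_aux]
    | hadd y y' hy hy' => simp only [add_mul_aux, mul_add_aux, hy, hy']
    | hs b s =>
      induction z using induction with
      | h0 => simp only [mul_zero_aux]
      | hadd z z' hz hz' => simp only [mul_add_aux, hz, hz']
      | hs c t =>
        simp only [single_mul_single, mul_assoc, map_mul, S.action]
        congr 1
        linear_combination (S.σ (b * c) r * S.σ c s * t) * S.cocycle a b c

theorem one_mul_aux (x : CrossedProduct S) : 1 * x = x := by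
  induction x using induction with
  | h0 => exact mul_zero_aux S 1
  | hadd x x' hx hx' => simp only [mul_add_aux, hx, hx']
  | hs a r =>
    rw [one_def, single_mul_single, one_mul, tau_one_left, ← map_mul, Units.mul_inv, map_one,
      one_mul]

theorem mul_one_aux (x : CrossedProduct S) : x * 1 = x := by
  induction x using induction with
  | h0 => exact zero_mul_aux S 1
  | hadd x x' hx hx' => simp only [add_mul_aux, hx, hx']
  | hs a r =>
    rw [one_def, single_mul_single, mul_one, tau_one_right, sigma_one, mul_right_comm,
      Units.mul_inv, one_mul]

instance : Ring (CrossedProduct S) where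
  __ := (inferInstance : AddCommGroup (CrossedProduct S))
  left_distrib := mul_add_aux S
  right_distrib := add_mul_aux S
  zero_mul := zero_mul_aux S
  mul_zero := mul_zero_aux S
  mul_assoc := mul_assoc_aux S
  one_mul := one_mul_aux S
  mul_one := mul_one_aux S

theorem smul_mul_aux (c : F) (x y : CrossedProduct S) : c • x * y = c • (x * y) := by
  induction x using induction with
  | h0 => simp only [smul_zero, zero_mul]
  | hadd x x' hx hx' => simp only [smul_add, add_mul, hx, hx']
  | hs a r =>
    induction y using induction with
    | h0 => simp only [smul_zero, mul_zero]
    | hadd y y' hy hy' => simp only [smul_add, mul_add, hy, hy']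
    | hs b s =>
      simp only [smul_single, single_mul_single, map_smul, mul_smul_comm, smul_mul_assoc]

theorem mul_smul_aux (c : F) (x y : CrossedProduct S) : x * c • y = c • (x * y) := by
  induction x using induction with
  | h0 => simp only [smul_zero, zero_mul]
  | hadd x x' hx hx' => simp only [smul_add, add_mul, hx, hx']
  | hs a r =>
    induction y using induction with
    | h0 => simp only [smul_zero, mul_zero]
    | hadd y y' hy hy' => simp only [smul_add, mul_add, hy, hy']
    | hs b s =>
      simp only [smul_single, single_mul_single, mul_smul_comm]

instance : Algebra F (CrossedProduct S) :=
  Algebra.ofModule (smul_mul_aux S) (mul_smul_aux S)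

end CrossedProduct

end GroupAlgebraIdempotents

end

open GroupAlgebraIdempotents

/-! Write `L = F(ζ_k)`, let `χ` be the character of `H` inflated from a faithful character of `H/K`,
and put `ε = charTwist χ 1`, which is `ε_C(H, K)`. Everything rests on viewing `ε` as the value at
`1` of an `F`-linear map `r ↦ charTwist χ r` from `L` to `FG`. By orthogonality of linear
characters, and because an automorphism in `Gal(L/F)` is determined by its effect on the values of
`χ`, this map is injective and multiplicative (`IsSeparating.charTwist_mul`,
`IsSeparating.charTwist_injective`). It embeds `L` as `FHε`, with `h ∈ H` acting as the scalar
`χ(h)`.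

An element of `E` normalizes this copy of `L` and acts on it through a Galois automorphism; for `g ∉
E` one has `ε g ε = 0`. If `g` normalizes `K`, this is because `χ` and its conjugate are not Galois
conjugate; otherwise `ε` lies under `ε(H, K)` and the orthogonality condition on strong Shoda pairs
applies. Hence `ε FG ε` is the sum of the pieces `φ(q) L` for `q ∈ E/H`, which is the crossed
product, and the conjugates of `ε` are `[G:E]` orthogonal idempotents with sum `e_C`. Peirce
decomposition gives the matrix algebra.

For primitivity, a central idempotent cut down by `ε` commutes with `H`. Since `H/K` is its own
centralizer in `N_G(K)/K`, averaging over `H` forces the result into the field `L`, where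
idempotents are `0` or `1` (`IsStableChar.exists_of_commute`).

For the second statement, a primitive central idempotent `e` of `FG` is not killed by some primitive
central idempotent of `ℚG`, say `e(G, H, K)`. Over `F`, `[L:F] ε(H, K)` is the sum of the `charTwist
χ 1` over all faithful `χ`, so `e` has nonzero product with one of them, hence with some `e_C(G, H,
K)`. Two primitive central idempotents with nonzero product coincide. -/

namespace GroupAlgebraIdempotents

open MonoidAlgebra

/-! ### Embedding `L` in `FH` by means of a linear character. -/

section Twist

variable {G : Type*} [Group G] [Finite G] {F : Type*} [Field F] {L : Type*} [Field L]
  [Algebra F L] {H : Subgroup G}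

/-- `|H|⁻¹ ∑_{h ∈ H} tr(r χ(h)) h⁻¹`, as a linear function of `r`. -/
noncomputable def charTwist (χ : H →* L) : L →ₗ[F] MonoidAlgebra F G where
  toFun r := (Nat.card H : F)⁻¹ • ∑ᶠ h : H, single (h : G)⁻¹ (Algebra.trace F L (r * χ h))
  map_add' r s := by
    have := Fintype.ofFinite H
    simp only [finsum_eq_sum_of_fintype, add_mul, map_add, single_add, Finset.sum_add_distrib,
      smul_add]
  map_smul' c r := by
    have := Fintype.ofFinite H
    simp only [finsum_eq_sum_of_fintype, smul_mul_assoc, map_smul, ← smul_single,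
      ← Finset.smul_sum, RingHom.id_apply]
    rw [smul_comm]

theorem charTwist_apply [Fintype H] (χ : H →* L) (r : L) :
    charTwist (F := F) χ r =
      (Nat.card H : F)⁻¹ • ∑ h : H, single (h : G)⁻¹ (Algebra.trace F L (r * χ h)) := by
  simp [charTwist, finsum_eq_sum_of_fintype]

/-- Translating the summation variable moves `h` into the trace. This makes `H` act on the image of
`charTwist χ` through scalars of `L`. -/
theorem of_mul_charTwist (χ : H →* L) (h : H) (r : L) :
    of F G h * charTwist χ r = charTwist χ (χ h * r) := by
  have := Fintype.ofFinite H
  rw [charTwist_apply, charTwist_apply, mul_smul_comm, Finset.mul_sum]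
  congr 1
  refine Fintype.sum_equiv (Equiv.mulRight h⁻¹) _ _ fun x => ?_
  rw [of_apply, single_mul_single, one_mul]
  congr 1
  · simp
  · rw [Equiv.coe_mulRight, mul_comm (χ h), mul_assoc, mul_comm (χ h), ← map_mul χ,
      inv_mul_cancel_right]

theorem charTwist_mul_of (χ : H →* L) (h : H) (r : L) :
    charTwist χ r * of F G h = charTwist χ (χ h * r) := by
  have := Fintype.ofFinite H
  rw [charTwist_apply, charTwist_apply, smul_mul_assoc, Finset.sum_mul]
  congr 1
  refine Fintype.sum_equiv (Equiv.mulLeft h⁻¹) _ _ fun x => ?_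
  rw [of_apply, single_mul_single, mul_one]
  congr 1
  · simp
  · rw [Equiv.coe_mulLeft, mul_comm (χ h), mul_assoc, ← map_mul χ, mul_inv_cancel_left]

/-- The trace is Galois invariant, so the automorphism `s` relating the two characters can be
transferred to the parameter `r`. -/
theorem of_mul_charTwist_mul_of (χ ψ : H →* L) (g : G) (e : H ≃ H)
    (he : ∀ h, (e h : G) = g⁻¹ * h * g) (s : L ≃ₐ[F] L) (hψ : ∀ h, ψ (e h) = s (χ h)) (r : L) :
    of F G g⁻¹ * charTwist χ r * of F G g = charTwist ψ (s r) := by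
  have := Fintype.ofFinite H
  rw [charTwist_apply, charTwist_apply, mul_smul_comm, smul_mul_assoc, Finset.mul_sum,
    Finset.sum_mul]
  congr 1
  refine Fintype.sum_equiv e _ _ fun x => ?_
  rw [of_apply, of_apply, single_mul_single, single_mul_single, mul_one, one_mul, hψ, ← map_mul,
    Algebra.trace_eq_of_algEquiv, he]
  congr 1
  group

/-- Each `h⁻¹` occurring in the first factor acts on the second as the scalar `ψ h⁻¹`; products are
thereby reduced to a character sum in `L`. -/
theorem charTwist_mul_charTwist [Fintype H] (χ ψ : H →* L) (r t : L) :
    charTwist χ r * charTwist ψ t = charTwist (F := F) ψ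
      (((Nat.card H : F)⁻¹ • ∑ h : H, Algebra.trace F L (r * χ h) • ψ h⁻¹) * t) := by
  rw [charTwist_apply, smul_mul_assoc, Finset.sum_mul, smul_mul_assoc, map_smul, Finset.sum_mul,
    map_sum]
  congr 1
  refine Finset.sum_congr rfl fun h _ => ?_
  rw [smul_mul_assoc, map_smul, ← of_mul_charTwist, ← smul_mul_assoc, of_apply, smul_single,
    smul_eq_mul, mul_one, InvMemClass.coe_inv]

theorem coeff_charTwist (χ : H →* L) (r : L) (h : H) :
    (charTwist (F := F) χ r).coeff (h : G)⁻¹ = (Nat.card H : F)⁻¹ * Algebra.trace F L (r * χ h) := by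
  classical
  have := Fintype.ofFinite H
  simp [charTwist_apply, Finsupp.single_apply]

theorem coeff_charTwist_of_notMem (χ : H →* L) (r : L) {g : G} (hg : g ∉ H) :
    (charTwist (F := F) χ r).coeff g = 0 := by
  classical
  have := Fintype.ofFinite H
  rw [charTwist_apply]
  simp only [coeff_smul, coeff_sum, coeff_single, Finsupp.smul_apply, Finsupp.finsetSum_apply]
  rw [Finset.sum_eq_zero, smul_zero]
  intro h _
  rw [Finsupp.single_apply, if_neg]
  rintro rfl
  exact hg (inv_mem h.2)

omit [Finite G] in
open scoped Classical in
theorem sum_mul_inv_apply (χ ψ : H →* L) [Fintype H] :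
    ∑ h : H, χ h * ψ h⁻¹ = if χ = ψ then (Nat.card H : L) else 0 := by
  have inv (h : H) : ψ h * ψ h⁻¹ = 1 := by rw [← map_mul, mul_inv_cancel, map_one]
  let f : H →* L :=
    { toFun := fun h => χ h * ψ h⁻¹
      map_one' := by simp
      map_mul' := fun a b => by
        rw [mul_inv_rev, map_mul, map_mul]; ring }
  have hf : f = 1 ↔ χ = ψ := by
    refine DFunLike.ext_iff.trans (.trans (forall_congr' fun h => ?_) DFunLike.ext_iff.symm)
    change χ h * ψ h⁻¹ = 1 ↔ _
    constructor
    · intro e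
      rw [← mul_one (χ h), ← inv h, mul_comm (ψ h), ← mul_assoc, e, one_mul]
    · intro e
      rw [e, inv]
  rw [Nat.card_eq_fintype_card, ← if_congr hf rfl rfl]
  exact (sum_hom_units f).trans (Nat.cast_ite ..|>.trans (by rw [Nat.cast_zero]))

open scoped Classical in
-- Expand the trace over `Gal(L/F)`: the sum over `H` is then orthogonality of `s ∘ χ` and `ψ`, and
-- only the `s` carrying `χ` to `ψ` survive.
theorem sum_trace_smul [CharZero F] [FiniteDimensional F L] [IsGalois F L] [Fintype H]
    (χ ψ : H →* L) (r : L) :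
    (Nat.card H : F)⁻¹ • ∑ h : H, Algebra.trace F L (r * χ h) • ψ h⁻¹ =
      ∑ s : L ≃ₐ[F] L, if ∀ h, s (χ h) = ψ h then s r else 0 := by
  have hH : (Nat.card H : F) ≠ 0 := by exact_mod_cast Nat.card_pos.ne'
  have key (s : L ≃ₐ[F] L) : ∑ h : H, s (χ h) * ψ h⁻¹ =
      if ∀ h, s (χ h) = ψ h then (Nat.card H : L) else 0 := by
    refine (sum_mul_inv_apply ((s : L →* L).comp χ) ψ).trans (if_congr ?_ rfl rfl)
    exact DFunLike.ext_iff
  rw [inv_smul_eq_iff₀ hH, Finset.smul_sum]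
  simp only [Algebra.smul_def, trace_eq_sum_automorphisms, Finset.sum_mul, map_mul]
  rw [Finset.sum_comm]
  refine Finset.sum_congr rfl fun s _ => ?_
  simp only [mul_assoc]
  rw [← Finset.mul_sum, key]
  split_ifs <;> simp [mul_comm]

section Separating

variable [CharZero F] [FiniteDimensional F L] [IsGalois F L] {χ : H →* L}

/-- A character `χ` with values in `L` is separating when distinct elements of `Gal(L / F)` have
distinct compositions with `χ`. -/
def IsSeparating (F : Type*) [Field F] [Algebra F L] (χ : H →* L) : Prop :=
  ∀ s t : L ≃ₐ[F] L, (∀ h, s (χ h) = t (χ h)) → s = t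

theorem IsSeparating.sum_trace_smul (hχ : IsSeparating F χ) [Fintype H] (r : L) :
    (Nat.card H : F)⁻¹ • ∑ h : H, Algebra.trace F L (r * χ h) • χ h⁻¹ = r := by
  classical
  rw [GroupAlgebraIdempotents.sum_trace_smul, Finset.sum_eq_single 1]
  · simp
  · intro s _ hs
    rw [if_neg]
    exact fun h => hs (hχ s 1 h)
  · simp

theorem IsSeparating.charTwist_mul (hχ : IsSeparating F χ) (r t : L) :
    charTwist χ r * charTwist χ t = charTwist (F := F) χ (r * t) := by
  have := Fintype.ofFinite H
  rw [charTwist_mul_charTwist, hχ.sum_trace_smul]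

theorem charTwist_mul_eq_zero (χ ψ : H →* L) (h : ∀ s : L ≃ₐ[F] L, ∃ h, s (χ h) ≠ ψ h) (r t : L) :
    charTwist χ r * charTwist ψ t = (0 : MonoidAlgebra F G) := by
  classical
  have := Fintype.ofFinite H
  rw [charTwist_mul_charTwist, GroupAlgebraIdempotents.sum_trace_smul, Finset.sum_eq_zero, zero_mul,
    map_zero]
  intro s _
  obtain ⟨x, hx⟩ := h s
  exact if_neg fun h => hx (h x)

/-- The coefficients are the traces of `r χ(h)` up to the factor `|H|⁻¹`, and Fourier inversion
recovers `r` from them. -/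
theorem IsSeparating.charTwist_injective (hχ : IsSeparating F χ) :
    Function.Injective (charTwist (F := F) χ) := by
  have := Fintype.ofFinite H
  rw [injective_iff_map_eq_zero]
  intro r hr
  have hH : (Nat.card H : F) ≠ 0 := by exact_mod_cast Nat.card_pos.ne'
  rw [← hχ.sum_trace_smul r]
  have (h : H) : Algebra.trace F L (r * χ h) = 0 := by
    have := coeff_charTwist (F := F) χ r h
    rw [hr] at this
    simpa [hH] using this
  simp [this]

end Separating

end Twist

/-! ### Conjugation in the group algebra. -/

section Conj

variable {G : Type*} [Group G] {F : Type*} [Field F]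

theorem conj_def (α : MonoidAlgebra F G) (g : G) :
    conj α g = of F G g⁻¹ * α * of F G g := rfl

theorem conj_one_right (α : MonoidAlgebra F G) : conj α 1 = α := by
  rw [conj_def, inv_one, map_one, one_mul, mul_one]

theorem of_mul_of_inv (g : G) : of F G g * of F G g⁻¹ = 1 := by
  rw [← map_mul, mul_inv_cancel, map_one]

theorem of_inv_mul_of (g : G) : of F G g⁻¹ * of F G g = 1 := by
  rw [← map_mul, inv_mul_cancel, map_one]

theorem conj_conj (α : MonoidAlgebra F G) (g h : G) : conj (conj α g) h = conj α (g * h) := by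
  simp only [conj_def, mul_inv_rev, map_mul, mul_assoc]

theorem conj_mul (α β : MonoidAlgebra F G) (g : G) : conj (α * β) g = conj α g * conj β g := by
  simp only [conj_def, mul_assoc]
  rw [← mul_assoc (of F G g) (of F G g⁻¹), of_mul_of_inv, one_mul]

theorem mem_center_of_conj {α : MonoidAlgebra F G} (h : ∀ g, conj α g = α) :
    α ∈ Subring.center (MonoidAlgebra F G) := by
  rw [Subring.mem_center_iff]
  intro x
  induction x using MonoidAlgebra.induction_on with
  | of g =>
    conv_lhs => rw [← h g, conj_def]
    rw [← mul_assoc, ← mul_assoc, of_mul_of_inv, one_mul]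
  | add x y hx hy => rw [add_mul, mul_add, hx, hy]
  | smul r x hx => rw [smul_mul_assoc, mul_smul_comm, hx]

end Conj

/-! ### The sum of the conjugates of `ε` and its primitivity. -/

section Stable

variable {G : Type*} [Group G] [Finite G] {F : Type*} [Field F] {L : Type*} [Field L]
  [Algebra F L] {H : Subgroup G}

/-- A separating character `χ` of `H` whose class under `Gal(L / F)` is stabilized by `E`, such that
the `G`-conjugates of the idempotent `charTwist χ 1` by elements outside of `E` are orthogonal to
it, and such that only `H` acts trivially on `χ`. -/
structure IsStableChar (F : Type*) [Field F] [Algebra F L] (χ : H →* L) (E : Subgroup G) :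
    Prop where
  le : H ≤ E
  sep : IsSeparating F χ
  act : ∀ g ∈ E, ∃ (e : H ≃ H) (s : L ≃ₐ[F] L), (∀ h, (e h : G) = g⁻¹ * h * g) ∧
    ∀ h, χ (e h) = s (χ h)
  orth : ∀ g ∉ E, charTwist (F := F) χ 1 * of F G g * charTwist χ 1 = 0
  faithful : ∀ g ∈ E, (∀ h h' : H, (h' : G) = g⁻¹ * h * g → χ h' = χ h) → g ∈ H

namespace IsStableChar

variable {χ : H →* L} {E : Subgroup G} (hχ : IsStableChar F χ E)

include hχ

theorem conj_charTwist {g : G} (hg : g ∈ E) {s : L ≃ₐ[F] L}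
    (hs : ∀ h h' : H, (h' : G) = g⁻¹ * h * g → χ h' = s (χ h)) (r : L) :
    conj (charTwist (F := F) χ r) g = charTwist χ (s r) := by
  obtain ⟨e, -, he, -⟩ := hχ.act g hg
  exact of_mul_charTwist_mul_of χ χ g e he s (fun h => hs _ _ (he h)) r

theorem exists_act {g : G} (hg : g ∈ E) : ∃ s : L ≃ₐ[F] L,
    ∀ h h' : H, (h' : G) = g⁻¹ * h * g → χ h' = s (χ h) := by
  obtain ⟨e, s, he, hs⟩ := hχ.act g hg
  exact ⟨s, fun h h' hh => by rw [← hs, Subtype.ext (hh.trans (he h).symm)]⟩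

theorem conj_one {g : G} (hg : g ∈ E) :
    conj (charTwist (F := F) χ 1) g = charTwist χ 1 := by
  obtain ⟨s, hs⟩ := hχ.exists_act hg
  rw [hχ.conj_charTwist hg hs, map_one]

/-- Since `E` fixes `ε`, the conjugate `g ε g⁻¹` depends only on the left coset `gE`. The inverses
appear because `conj α g` is `g⁻¹ α g`. -/
theorem conj_out (g : G) :
    conj (charTwist (F := F) χ 1) (Quotient.out (g : G ⧸ E))⁻¹ = conj (charTwist χ 1) g⁻¹ := by
  have h : (Quotient.out (g : G ⧸ E))⁻¹ * g ∈ E :=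
    QuotientGroup.eq.mp (QuotientGroup.out_eq' _)
  have := hχ.conj_one (inv_mem h)
  rw [mul_inv_rev, inv_inv] at this
  conv_lhs => rw [← this, conj_conj]
  congr 1
  group

theorem mul_out_mul_of_ne {q q' : G ⧸ E} (h : q ≠ q') :
    charTwist (F := F) χ 1 * of F G ((Quotient.out q)⁻¹ * Quotient.out q') * charTwist χ 1 = 0 := by
  refine hχ.orth _ fun hE => h ?_
  rw [← QuotientGroup.out_eq' q, ← QuotientGroup.out_eq' q']
  exact QuotientGroup.eq.mpr hE

theorem conj_out_mul_of_ne {q q' : G ⧸ E} (h : q ≠ q') :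
    conj (charTwist (F := F) χ 1) (Quotient.out q)⁻¹ *
      conj (charTwist χ 1) (Quotient.out q')⁻¹ = 0 := by
  have := hχ.mul_out_mul_of_ne h
  rw [map_mul] at this
  have h2 : conj (charTwist (F := F) χ 1) (Quotient.out q)⁻¹ *
      conj (charTwist χ 1) (Quotient.out q')⁻¹ = of F G (Quotient.out q) *
        (charTwist (F := F) χ 1 * (of F G (Quotient.out q)⁻¹ * of F G (Quotient.out q')) *
        charTwist χ 1) * of F G (Quotient.out q')⁻¹ := by
    simp only [conj_def, mul_assoc, inv_inv]
  rw [h2, this, mul_zero, zero_mul]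

variable [CharZero F] [FiniteDimensional F L] [IsGalois F L]

theorem mul_self : charTwist (F := F) χ 1 * charTwist χ 1 = charTwist χ 1 := by
  rw [hχ.sep.charTwist_mul, one_mul]

theorem ne_zero : charTwist (F := F) χ 1 ≠ 0 := by
  rw [Ne, map_eq_zero_iff _ hχ.sep.charTwist_injective]
  exact one_ne_zero

theorem conj_out_injective : Function.Injective fun q : G ⧸ E =>
    conj (charTwist (F := F) χ 1) (Quotient.out q)⁻¹ := by
  intro q q' hq
  by_contra hne
  have h0 := hχ.conj_out_mul_of_ne hne
  dsimp only at hq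
  rw [← hq, ← conj_mul, hχ.mul_self] at h0
  apply hχ.ne_zero
  have := conj_conj (charTwist (F := F) χ 1) (Quotient.out q)⁻¹ (Quotient.out q)
  rw [h0, inv_mul_cancel] at this
  rw [conj_one_right] at this
  rw [← this, conj_def, mul_zero, zero_mul]

theorem sumConj_eq [Fintype (G ⧸ E)] : sumConj (charTwist (F := F) χ 1) =
    ∑ q : G ⧸ E, conj (charTwist (F := F) χ 1) (Quotient.out q)⁻¹ := by
  have hr : Set.range (conj (charTwist (F := F) χ 1)) = Set.range fun q : G ⧸ E =>
      conj (charTwist (F := F) χ 1) (Quotient.out q)⁻¹ := by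
    apply Set.Subset.antisymm
    · rintro _ ⟨g, rfl⟩
      exact ⟨(g⁻¹ : G), by rw [← inv_inv g, ← hχ.conj_out, inv_inv]⟩
    · rintro _ ⟨q, rfl⟩
      exact ⟨_, rfl⟩
  rw [sumConj, hr, finsum_mem_range hχ.conj_out_injective, finsum_eq_sum_of_fintype]

theorem sumConj_mul_conj (g : G) : sumConj (charTwist (F := F) χ 1) * conj (charTwist χ 1) g =
    conj (charTwist χ 1) g := by
  classical
  have := Fintype.ofFinite (G ⧸ E)
  rw [hχ.sumConj_eq, ← inv_inv g, ← hχ.conj_out, Finset.sum_mul,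
    Finset.sum_eq_single ((g⁻¹ : G) : G ⧸ E), ← conj_mul, hχ.mul_self]
  · intro q _ hq
    exact hχ.conj_out_mul_of_ne hq
  · simp

theorem sumConj_mul : sumConj (charTwist (F := F) χ 1) * charTwist χ 1 = charTwist χ 1 := by
  simpa only [conj_one_right] using hχ.sumConj_mul_conj 1

theorem isIdempotentElem_sumConj : IsIdempotentElem (sumConj (charTwist (F := F) χ 1)) := by
  have := Fintype.ofFinite (G ⧸ E)
  change _ * _ = _
  conv_lhs => enter [2]; rw [hχ.sumConj_eq]
  simp only [Finset.mul_sum, hχ.sumConj_mul_conj]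
  rw [hχ.sumConj_eq]

theorem sumConj_mem_center :
    sumConj (charTwist (F := F) χ 1) ∈ Subring.center (MonoidAlgebra F G) := by
  have := Fintype.ofFinite (G ⧸ E)
  refine mem_center_of_conj fun g => ?_
  rw [hχ.sumConj_eq, conj_def, Finset.mul_sum, Finset.sum_mul]
  refine Fintype.sum_equiv (MulAction.toPerm g⁻¹) _ _ fun q => ?_
  change conj (conj _ _) g = _
  rw [conj_conj]
  conv_rhs => rw [← QuotientGroup.out_eq' q]
  change _ = conj _ (Quotient.out ((g⁻¹ * Quotient.out q : G) : G ⧸ E))⁻¹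
  rw [hχ.conj_out, mul_inv_rev, inv_inv]

/-- Averaging over conjugation by `H` fixes `ε x ε`, while it sends `ε g ε` into the copy of `L` for
every `g`. Indeed `ε g ε` vanishes for `g ∉ E`; for `g ∈ E` acting by `s`, orthogonality of `s ∘ χ`
and `χ` kills the average unless `s ∘ χ = χ`, in which case `g ∈ H`. -/
theorem exists_of_commute {x : MonoidAlgebra F G} (hx : ∀ h : H, of F G h * x = x * of F G h) :
    ∃ r, charTwist χ 1 * x * charTwist χ 1 = charTwist (F := F) χ r := by
  classical
  have := Fintype.ofFinite H
  have hH : (Nat.card H : F) ≠ 0 := by exact_mod_cast Nat.card_pos.ne'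
  have key (x : MonoidAlgebra F G) : ∑ h : H, of F G h * (charTwist χ 1 * x * charTwist χ 1) *
      of F G (h : G)⁻¹ ∈ LinearMap.range (charTwist (F := F) χ) := by
    induction x using MonoidAlgebra.induction_on with
    | of g =>
      by_cases hg : g ∈ E
      · obtain ⟨e, s, he, hs⟩ := hχ.act g hg
        have hs' : ∀ h h' : H, (h' : G) = g⁻¹ * h * g → χ h' = s (χ h) := fun h h' hh => by
          rw [← hs, Subtype.ext (hh.trans (he h).symm)]
        have comm (r : L) : charTwist (F := F) χ r * of F G g = of F G g * charTwist χ (s r) := by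
          rw [← hχ.conj_charTwist hg hs', conj_def, ← mul_assoc, ← mul_assoc, of_mul_of_inv, one_mul]
        have term (h : H) : of F G h * (charTwist χ 1 * of F G g * charTwist χ 1) *
            of F G (h : G)⁻¹ = of F G g * charTwist χ (s (χ h) * χ h⁻¹) := by
          rw [← mul_assoc, ← mul_assoc, of_mul_charTwist, comm, mul_assoc, mul_assoc]
          rw [← InvMemClass.coe_inv, charTwist_mul_of, hχ.sep.charTwist_mul]
          simp
        simp only [term]
        rw [← Finset.mul_sum, ← map_sum]
        have h1 := sum_mul_inv_apply ((s : L →* L).comp χ) χ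
        simp only [MonoidHom.comp_apply, MonoidHom.coe_coe] at h1
        rw [h1]
        split_ifs with hc
        · have hgH : g ∈ H := hχ.faithful g hg fun h h' hh => by
            rw [hs' h h' hh]; exact DFunLike.congr_fun hc h
          exact ⟨_, (of_mul_charTwist χ ⟨g, hgH⟩ _).symm⟩
        · rw [map_zero, mul_zero]; exact zero_mem _
      · simp only [hχ.orth g hg, mul_zero, zero_mul, Finset.sum_const_zero]
        exact zero_mem _
    | add x y hx hy =>
      simp only [mul_add, add_mul, Finset.sum_add_distrib]
      exact add_mem hx hy
    | smul r x hx =>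
      simp only [mul_smul_comm, smul_mul_assoc, ← Finset.smul_sum]
      exact Submodule.smul_mem _ _ hx
  have h2 : ∑ h : H, of F G h * (charTwist χ 1 * x * charTwist χ 1) * of F G (h : G)⁻¹ =
      (Nat.card H : F) • (charTwist χ 1 * x * charTwist χ 1) := by
    rw [Finset.sum_congr rfl fun h _ => ?_, Finset.sum_const, Finset.card_univ,
      Nat.card_eq_fintype_card, Nat.cast_smul_eq_nsmul]
    have c : of F G h * charTwist χ 1 = charTwist χ 1 * of F G h := by
      rw [of_mul_charTwist, charTwist_mul_of]
    rw [← mul_assoc, ← mul_assoc, c, mul_assoc (charTwist χ 1), hx, ← mul_assoc, mul_assoc _ _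
      (charTwist χ 1), c, ← mul_assoc, mul_assoc _ (of F G (h : G)), of_mul_of_inv, mul_one]
  have := key x
  rw [h2] at this
  obtain ⟨r, hr⟩ := (Submodule.smul_mem_iff _ hH).mp this
  exact ⟨r, hr.symm⟩

theorem eq_zero_of_mul_eq_zero {x : MonoidAlgebra F G}
    (hx : x ∈ Subring.center (MonoidAlgebra F G)) (h : x * charTwist χ 1 = 0) :
    x * sumConj (charTwist χ 1) = 0 := by
  have := Fintype.ofFinite (G ⧸ E)
  rw [hχ.sumConj_eq, Finset.mul_sum]
  refine Finset.sum_eq_zero fun q _ => ?_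
  rw [conj_def, ← mul_assoc, ← mul_assoc, ← Subring.mem_center_iff.mp hx, mul_assoc _ x, h, mul_zero,
    zero_mul]

theorem isPrimitiveCentralIdempotent :
    IsPrimitiveCentralIdempotent (sumConj (charTwist (F := F) χ 1)) where
  idem := hχ.isIdempotentElem_sumConj
  central := hχ.sumConj_mem_center
  ne_zero h := hχ.ne_zero (by rw [← hχ.sumConj_mul, h, zero_mul])
  primitive e₁ e₂ h₁ h₂ hc₁ hc₂ h0 he := by
    have h0' : e₂ * e₁ = 0 := by rw [Subring.mem_center_iff.mp hc₁, h0]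
    have m₁ : e₁ * sumConj (charTwist (F := F) χ 1) = e₁ := by rw [he, mul_add, h₁.eq, h0, add_zero]
    have m₂ : e₂ * sumConj (charTwist (F := F) χ 1) = e₂ := by
      rw [he, mul_add, h₂.eq, h0', zero_add]
    -- `e₁ ε` is an idempotent of the field `L`: if it is `0`, then `e₁` vanishes; if it is `ε`,
    -- then `e₂ ε = e₂ e₁ ε = 0` and `e₂` vanishes.
    obtain ⟨r, hr⟩ := hχ.exists_of_commute (x := e₁) fun h => Subring.mem_center_iff.mp hc₁ _
    rw [Subring.mem_center_iff.mp hc₁, mul_assoc, hχ.mul_self] at hr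
    have hrr : r * r = r := by
      apply hχ.sep.charTwist_injective
      rw [← hχ.sep.charTwist_mul, ← hr, mul_assoc, ← mul_assoc _ e₁, Subring.mem_center_iff.mp hc₁,
        mul_assoc, hχ.mul_self, ← mul_assoc, h₁.eq]
    rcases (IsIdempotentElem.iff_eq_zero_or_one (p := r)).mp hrr with rfl | rfl
    · left
      rw [← m₁, hχ.eq_zero_of_mul_eq_zero hc₁ (by rw [hr, map_zero])]
    · right
      rw [← m₂, hχ.eq_zero_of_mul_eq_zero hc₂ (by rw [← hr, ← mul_assoc, h0', zero_mul])]

end IsStableChar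

end Stable

/-! ### The corner `ε FG ε` as a crossed product. -/

section Crossed

variable {G : Type*} [Group G] [Finite G] {F : Type*} [Field F] {L : Type*} [Field L]
  [Algebra F L] {H : Subgroup G} {χ : H →* L} {E : Subgroup G} [(H.subgroupOf E).Normal]

/-- A crossed system describes the extension of the character `χ` of `H` to `E` with respect to
the set `φ` of representatives of `E / H`. -/
structure IsAdapted (χ : H →* L) (φ : E ⧸ H.subgroupOf E → E)
    (S : CrossedSystem F L (E ⧸ H.subgroupOf E)) : Prop where
  section_eq : ∀ q, (φ q : E ⧸ H.subgroupOf E) = q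
  σ_eq : ∀ q (h h' : H), (h' : G) = (φ q : G)⁻¹ * h * φ q → χ h' = S.σ q (χ h)
  τ_eq : ∀ a b (h : H), (h : G) = (φ (a * b) : G)⁻¹ * φ a * φ b → χ h = S.τ a b

omit [Finite G] in
theorem inv_mul_mem_of_section {φ : E ⧸ H.subgroupOf E → E}
    (hφ : ∀ q, (φ q : E ⧸ H.subgroupOf E) = q) (a b : E ⧸ H.subgroupOf E) :
    (φ (a * b) : G)⁻¹ * φ a * φ b ∈ H := by
  have : (φ (a * b))⁻¹ * (φ a * φ b) ∈ H.subgroupOf E := by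
    rw [← QuotientGroup.eq, hφ, QuotientGroup.mk_mul, hφ, hφ]
  rw [mul_assoc]
  exact this

/-- The twisting is `χ` applied to the factor set of `φ` in `H`, so the cocycle identity is
associativity in `E`. The action has no inner correction because `L` is commutative. -/
theorem IsStableChar.exists_isAdapted (hχ : IsStableChar F χ E) (φ : E ⧸ H.subgroupOf E → E)
    (hφ : ∀ q, (φ q : E ⧸ H.subgroupOf E) = q) :
    ∃ S : CrossedSystem F L (E ⧸ H.subgroupOf E), IsAdapted χ φ S := by
  choose s hs using fun g : E => hχ.exists_act g.2
  have hn (g : E) (h : H) : (g : G)⁻¹ * h * g ∈ H := by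
    obtain ⟨e, -, he, -⟩ := hχ.act g g.2
    rw [← he]
    exact (e h).2
  let c (a b : E ⧸ H.subgroupOf E) : H := ⟨_, inv_mul_mem_of_section hφ a b⟩
  have hc (a b) : (c a b : G) = (φ (a * b) : G)⁻¹ * φ a * φ b := rfl
  have hne (h : H) : χ h ≠ 0 := fun h0 => one_ne_zero (α := L) <| by
    rw [← map_one χ, ← mul_inv_cancel h, map_mul, h0, zero_mul]
  have hcs (a b : E ⧸ H.subgroupOf E) (r : L) : s (φ b) (s (φ a) r) = s (φ (a * b)) r := by
    refine DFunLike.congr_fun (hχ.sep ((s (φ a)).trans (s (φ b))) _ fun h => ?_) r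
    rw [AlgEquiv.trans_apply, ← hs (φ a) h ⟨_, hn _ _⟩ rfl, ← hs (φ b) _ ⟨_, hn _ _⟩ rfl,
      ← hs (φ (a * b)) h ⟨_, hn _ _⟩ rfl]
    -- Conjugation by `φ a * φ b` and by `φ (a * b)` differ by conjugation with an element of `H`,
    -- which `χ` does not see.
    have : (⟨_, hn (φ b) ⟨_, hn (φ a) h⟩⟩ : H) = (c a b)⁻¹ * ⟨_, hn (φ (a * b)) h⟩ * c a b := by
      ext
      simp only [Subgroup.coe_mul, InvMemClass.coe_inv, hc]
      group
    rw [this, map_mul, map_mul, mul_right_comm, ← map_mul, inv_mul_cancel, map_one, one_mul]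
  refine ⟨⟨fun q => s (φ q), fun a b => Units.mk0 (χ (c a b)) (hne _), hcs, fun a b d => ?_⟩,
    hφ, fun q => hs (φ q), fun a b h hh => ?_⟩
  · rw [Units.val_mk0, Units.val_mk0, Units.val_mk0, Units.val_mk0,
      ← hs (φ d) (c a b) ⟨_, hn _ _⟩ rfl, ← map_mul, ← map_mul]
    congr 1
    ext
    simp only [Subgroup.coe_mul, hc, mul_assoc a b d]
    group
  · rw [Units.val_mk0, Subtype.ext (hh.trans (hc a b).symm)]

variable (χ) in
/-- The map `u_g r ↦ φ(g) · charTwist χ r` from a crossed product to the group algebra. -/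
noncomputable def crossedHom (φ : E ⧸ H.subgroupOf E → E)
    (S : CrossedSystem F L (E ⧸ H.subgroupOf E)) : CrossedProduct S →ₗ[F] MonoidAlgebra F G :=
  (Finsupp.lsum F fun q => (LinearMap.mulLeft F (of F G (φ q))) ∘ₗ charTwist χ :
    ((E ⧸ H.subgroupOf E) →₀ L) →ₗ[F] MonoidAlgebra F G)

theorem crossedHom_single (φ : E ⧸ H.subgroupOf E → E)
    (S : CrossedSystem F L (E ⧸ H.subgroupOf E)) (q : E ⧸ H.subgroupOf E) (r : L) :
    crossedHom χ φ S (CrossedProduct.single S q r) = of F G (φ q) * charTwist χ r := by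
  refine (Finsupp.lsum_single F _ q r).trans ?_
  rfl

omit [(H.subgroupOf E).Normal] in
-- The summands are supported on distinct cosets `φ(q)H`, so each can be read off separately;
-- injectivity of `crossedHom` follows.
theorem coeff_sum_of_mul_charTwist {φ : E ⧸ H.subgroupOf E → E}
    (hφ : ∀ q, (φ q : E ⧸ H.subgroupOf E) = q) (f : (E ⧸ H.subgroupOf E) →₀ L)
    (q : E ⧸ H.subgroupOf E) {g : G} (hg : g ∈ H) :
    (f.sum fun q r => of F G (φ q) * charTwist χ r).coeff (φ q * g) =
      (charTwist (F := F) χ (f q)).coeff g := by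
  rw [Finsupp.sum, coeff_sum, Finsupp.finsetSum_apply, Finset.sum_eq_single q]
  · rw [of_apply, coeff_single_mul_apply, one_mul, inv_mul_cancel_left]
  · intro q' _ hne
    rw [of_apply, coeff_single_mul_apply, one_mul]
    refine coeff_charTwist_of_notMem _ _ fun hmem => hne ?_
    rw [← mul_assoc, H.mul_mem_cancel_right hg] at hmem
    rw [← hφ q, ← hφ q']
    exact QuotientGroup.eq.mpr hmem
  · intro hq
    rw [Finsupp.notMem_support_iff.mp hq, map_zero, mul_zero, coeff_zero, Finsupp.zero_apply]

namespace IsAdapted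

variable {φ : E ⧸ H.subgroupOf E → E} {S : CrossedSystem F L (E ⧸ H.subgroupOf E)}
  (hS : IsAdapted χ φ S) (hχ : IsStableChar F χ E)

include hS hχ

theorem charTwist_mul_of (q : E ⧸ H.subgroupOf E) (r : L) :
    charTwist (F := F) χ r * of F G (φ q) = of F G (φ q) * charTwist χ (S.σ q r) := by
  rw [← hχ.conj_charTwist (φ q).2 (hS.σ_eq q), conj_def, ← mul_assoc, ← mul_assoc, of_mul_of_inv,
    one_mul]

omit hχ in
theorem crossedHom_one : crossedHom χ φ S 1 = charTwist χ 1 := by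
  have h := inv_mul_mem_of_section hS.section_eq 1 1
  have h2 := hS.τ_eq 1 1 ⟨_, h⟩ rfl
  rw [CrossedProduct.one_def, crossedHom_single]
  -- The section need not be normalized: `φ 1` is some element of `H`, equal to the factor set at
  -- `(1, 1)`, and `χ` of it cancels the `τ(1, 1)⁻¹` in the unit of the crossed product.
  have h3 : (φ 1 : G) = (⟨_, h⟩ : H) := by simp
  rw [h3, of_mul_charTwist, h2, Units.mul_inv]

variable [CharZero F] [FiniteDimensional F L] [IsGalois F L]

theorem crossedHom_mul (x y : CrossedProduct S) :
    crossedHom χ φ S (x * y) = crossedHom χ φ S x * crossedHom χ φ S y := by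
  induction x using CrossedProduct.induction with
  | h0 => simp only [zero_mul, map_zero]
  | hadd x x' hx hx' => simp only [add_mul, map_add, hx, hx']
  | hs a r =>
    induction y using CrossedProduct.induction with
    | h0 => simp only [mul_zero, map_zero]
    | hadd y y' hy hy' => simp only [mul_add, map_add, hy, hy']
    | hs b t =>
      have h := inv_mul_mem_of_section hS.section_eq a b
      rw [CrossedProduct.single_mul_single, crossedHom_single, crossedHom_single,
        crossedHom_single, ← hS.τ_eq a b ⟨_, h⟩ rfl, mul_assoc, ← of_mul_charTwist,
        ← hχ.sep.charTwist_mul, mul_assoc (of F G (φ a)), ← mul_assoc (charTwist χ r),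
        hS.charTwist_mul_of hχ, ← mul_assoc, ← map_mul]
      have h3 : (φ (a * b) : G) * ((⟨_, h⟩ : H) : G) = φ a * φ b := by simp [mul_assoc]
      rw [h3, map_mul]
      simp only [mul_assoc]

theorem one_mul_crossedHom (x : CrossedProduct S) :
    charTwist χ 1 * crossedHom χ φ S x = crossedHom χ φ S x := by
  rw [← hS.crossedHom_one, ← hS.crossedHom_mul hχ, one_mul]

theorem crossedHom_mul_one (x : CrossedProduct S) :
    crossedHom χ φ S x * charTwist χ 1 = crossedHom χ φ S x := by
  rw [← hS.crossedHom_one, ← hS.crossedHom_mul hχ, mul_one]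

theorem crossedHom_injective : Function.Injective (crossedHom χ φ S) := by
  rw [injective_iff_map_eq_zero]
  intro x hx
  refine Finsupp.ext (f := (x : (E ⧸ H.subgroupOf E) →₀ L)) fun q => ?_
  apply hχ.sep.charTwist_injective
  refine Eq.trans ?_ (map_zero _).symm
  ext g
  rw [coeff_zero, Finsupp.zero_apply]
  by_cases hg : g ∈ H
  · have h1 : coeff (crossedHom χ φ S x) (φ q * g) = 0 := by rw [hx, coeff_zero, Finsupp.zero_apply]
    exact (coeff_sum_of_mul_charTwist hS.section_eq _ q hg).symm.trans h1
  · exact coeff_charTwist_of_notMem _ _ hg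

/-- Surjectivity onto the corner, checked on group elements: for `g ∈ E`, write `g` as a
representative times an element of `H`; for the others `ε g ε = 0`. -/
theorem exists_crossedHom_eq (x : MonoidAlgebra F G) :
    ∃ y, crossedHom χ φ S y = charTwist χ 1 * x * charTwist χ 1 := by
  change _ ∈ LinearMap.range (crossedHom χ φ S)
  induction x using MonoidAlgebra.induction_on with
  | of g =>
    by_cases hg : g ∈ E
    · have hh : ((φ ((⟨g, hg⟩ : E) : E ⧸ H.subgroupOf E) : E) : G)⁻¹ * g ∈ H := by
        have := QuotientGroup.eq.mp (hS.section_eq ((⟨g, hg⟩ : E) : E ⧸ H.subgroupOf E))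
        exact this
      refine ⟨CrossedProduct.single S ((⟨g, hg⟩ : E) : E ⧸ H.subgroupOf E) (χ ⟨_, hh⟩), ?_⟩
      have h1 := hχ.conj_one hg
      have h2 : charTwist (F := F) χ 1 * of F G g = of F G g * charTwist χ 1 := by
        conv_rhs => rw [← h1, conj_def, ← mul_assoc, ← mul_assoc, of_mul_of_inv, one_mul]
      rw [h2, mul_assoc, hχ.mul_self, crossedHom_single, ← mul_one (χ _), ← of_mul_charTwist,
        ← mul_assoc, ← map_mul, mul_inv_cancel_left]
    · rw [hχ.orth g hg]
      exact zero_mem _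
  | add x y hx hy =>
    rw [mul_add, add_mul]
    exact add_mem hx hy
  | smul r x hx =>
    rw [mul_smul_comm, smul_mul_assoc]
    exact Submodule.smul_mem _ _ hx

end IsAdapted

/-- The map sending a matrix `(m_{ij})` over a crossed product to `∑ g_i m_{ij} g_j⁻¹`, where the
`g_i` represent the left cosets of `E` in `G`. -/
noncomputable def matrixHom (χ : H →* L) (φ : E ⧸ H.subgroupOf E → E)
    (S : CrossedSystem F L (E ⧸ H.subgroupOf E)) [Fintype (G ⧸ E)] :
    Matrix (G ⧸ E) (G ⧸ E) (CrossedProduct S) →ₗ[F] MonoidAlgebra F G where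
  toFun M := ∑ i, ∑ j, of F G (Quotient.out i) * crossedHom χ φ S (M i j) *
    of F G (Quotient.out j)⁻¹
  map_add' M N := by
    simp only [Matrix.add_apply, map_add, mul_add, add_mul, Finset.sum_add_distrib]
  map_smul' c M := by
    simp only [Matrix.smul_apply, map_smul, mul_smul_comm, smul_mul_assoc, Finset.smul_sum,
      RingHom.id_apply]

theorem matrixHom_apply (φ : E ⧸ H.subgroupOf E → E)
    (S : CrossedSystem F L (E ⧸ H.subgroupOf E)) [Fintype (G ⧸ E)]
    (M : Matrix (G ⧸ E) (G ⧸ E) (CrossedProduct S)) :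
    matrixHom χ φ S M = ∑ i, ∑ j, of F G (Quotient.out i) * crossedHom χ φ S (M i j) *
      of F G (Quotient.out j)⁻¹ := rfl

/-! ### The block as a matrix algebra over the corner. -/

namespace IsAdapted

variable {φ : E ⧸ H.subgroupOf E → E} {S : CrossedSystem F L (E ⧸ H.subgroupOf E)}
  (hS : IsAdapted χ φ S) (hχ : IsStableChar F χ E) [Fintype (G ⧸ E)]
  [CharZero F] [FiniteDimensional F L] [IsGalois F L]

include hS hχ

omit [Fintype (G ⧸ E)] in
theorem crossedHom_mul_of_mul_crossedHom [DecidableEq (G ⧸ E)] (x y : CrossedProduct S)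
    (i j : G ⧸ E) :
    crossedHom χ φ S x * (of F G (Quotient.out i)⁻¹ * of F G (Quotient.out j)) *
      crossedHom χ φ S y = if i = j then crossedHom χ φ S (x * y) else 0 := by
  split_ifs with h
  · rw [h, of_inv_mul_of, mul_one, hS.crossedHom_mul hχ]
  · have := hχ.mul_out_mul_of_ne h
    rw [← hS.crossedHom_mul_one hχ x, ← hS.one_mul_crossedHom hχ y, ← mul_assoc,
      mul_assoc _ _ (of F G _ * _), ← map_mul, mul_assoc _ _ (charTwist χ 1), this, mul_zero,
      zero_mul]

theorem matrixHom_mul (M N : Matrix (G ⧸ E) (G ⧸ E) (CrossedProduct S)) :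
    matrixHom χ φ S (M * N) = matrixHom χ φ S M * matrixHom χ φ S N := by
  classical
  have key (i k l j : G ⧸ E) :
      of F G (Quotient.out i) * crossedHom χ φ S (M i k) * of F G (Quotient.out k)⁻¹ *
        (of F G (Quotient.out l) * crossedHom χ φ S (N l j) * of F G (Quotient.out j)⁻¹) =
      if k = l then of F G (Quotient.out i) * crossedHom χ φ S (M i k * N l j) *
        of F G (Quotient.out j)⁻¹ else 0 := by
    have h1 := hS.crossedHom_mul_of_mul_crossedHom hχ (M i k) (N l j) k l
    calc _ = of F G (Quotient.out i) * (crossedHom χ φ S (M i k) * (of F G (Quotient.out k)⁻¹ *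
          of F G (Quotient.out l)) * crossedHom χ φ S (N l j)) * of F G (Quotient.out j)⁻¹ := by
          simp only [mul_assoc]
      _ = _ := by
        rw [h1]
        split_ifs
        · rfl
        · rw [mul_zero, zero_mul]
  rw [matrixHom_apply, matrixHom_apply, matrixHom_apply, Finset.sum_mul]
  refine Finset.sum_congr rfl fun i _ => ?_
  rw [Finset.sum_mul]
  simp only [Finset.mul_sum, key, Matrix.mul_apply, map_sum, Finset.sum_mul]
  rw [Finset.sum_comm]
  refine Finset.sum_congr rfl fun k _ => ?_
  rw [Finset.sum_comm]
  simp

/-- Peirce components recover the entries of the matrix, whence injectivity of `matrixHom`. -/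
theorem mul_matrixHom_mul [DecidableEq (G ⧸ E)] (M : Matrix (G ⧸ E) (G ⧸ E) (CrossedProduct S))
    (i j : G ⧸ E) :
    charTwist χ 1 * of F G (Quotient.out i)⁻¹ * matrixHom χ φ S M * of F G (Quotient.out j) *
      charTwist χ 1 = crossedHom χ φ S (M i j) := by
  have key (a b : G ⧸ E) : charTwist χ 1 * of F G (Quotient.out i)⁻¹ *
      (of F G (Quotient.out a) * crossedHom χ φ S (M a b) * of F G (Quotient.out b)⁻¹) *
      of F G (Quotient.out j) * charTwist χ 1 =
      if i = a then if b = j then crossedHom χ φ S (M a b) else 0 else 0 := by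
    have h1 := hS.crossedHom_mul_of_mul_crossedHom hχ 1 (M a b) i a
    have h2 := hS.crossedHom_mul_of_mul_crossedHom hχ (M a b) 1 b j
    rw [hS.crossedHom_one, one_mul] at h1
    rw [hS.crossedHom_one, mul_one] at h2
    calc _ = (charTwist χ 1 * (of F G (Quotient.out i)⁻¹ *
      of F G (Quotient.out a)) * crossedHom χ φ S (M a b)) * (of F G (Quotient.out b)⁻¹ *
      of F G (Quotient.out j)) * charTwist χ 1 := by simp only [mul_assoc]
      _ = _ := by
        rw [h1]
        split_ifs with hi hj
        · rw [h2, if_pos hj]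
        · rw [h2, if_neg hj]
        · rw [zero_mul, zero_mul]
  simp only [matrixHom_apply, Finset.sum_mul, Finset.mul_sum, key]
  simp

theorem matrixHom_injective : Function.Injective (matrixHom χ φ S) := by
  classical
  rw [injective_iff_map_eq_zero]
  intro M hM
  ext1 i j
  apply hS.crossedHom_injective hχ
  rw [← hS.mul_matrixHom_mul hχ M i j, hM]
  simp

theorem matrixHom_mem_block (M : Matrix (G ⧸ E) (G ⧸ E) (CrossedProduct S)) :
    matrixHom χ φ S M ∈ block F (sumConj (charTwist (F := F) χ 1)) := by
  refine ⟨matrixHom χ φ S M, ?_⟩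
  have hc := Subring.mem_center_iff.mp hχ.sumConj_mem_center
  have key (y : CrossedProduct S) :
      crossedHom χ φ S y * sumConj (charTwist χ 1) = crossedHom χ φ S y := by
    rw [hc, ← hS.one_mul_crossedHom hχ, ← mul_assoc, hχ.sumConj_mul]
  simp only [matrixHom_apply, Finset.sum_mul]
  refine Finset.sum_congr rfl fun i _ => Finset.sum_congr rfl fun j _ => ?_
  rw [mul_assoc _ _ (sumConj _), hc, ← mul_assoc, mul_assoc _ _ (sumConj _), key]

theorem exists_matrixHom_eq {x : MonoidAlgebra F G}
    (hx : x ∈ block F (sumConj (charTwist (F := F) χ 1))) : ∃ M, matrixHom χ φ S M = x := by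
  obtain ⟨a, rfl⟩ := hx
  have hc := Subring.mem_center_iff.mp hχ.sumConj_mem_center
  have h1 : a * sumConj (charTwist (F := F) χ 1) =
      sumConj (charTwist χ 1) * a * sumConj (charTwist χ 1) := by
    rw [← hc, mul_assoc, hχ.isIdempotentElem_sumConj.eq]
  -- The matrix entries are `ε g_i⁻¹ a g_j ε`, from the decomposition of `e a e` along `e = ∑ g_i ε
  -- g_i⁻¹`.
  choose M hM using fun i j : G ⧸ E =>
    hS.exists_crossedHom_eq hχ (of F G (Quotient.out i)⁻¹ * a * of F G (Quotient.out j))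
  refine ⟨Matrix.of M, ?_⟩
  rw [h1, hχ.sumConj_eq, matrixHom_apply, Finset.sum_mul, Finset.sum_mul]
  refine Finset.sum_congr rfl fun i _ => ?_
  rw [Finset.mul_sum]
  refine Finset.sum_congr rfl fun j _ => ?_
  rw [Matrix.of_apply, hM]
  simp only [conj_def, inv_inv, mul_assoc]

theorem exists_equiv_block : ∃ f : block F (sumConj (charTwist (F := F) χ 1)) ≃ₗ[F]
    Matrix (Fin E.index) (Fin E.index) (CrossedProduct S), ∀ a b, f (a * b) = f a * f b := by
  classical
  let Θ : Matrix (G ⧸ E) (G ⧸ E) (CrossedProduct S) →ₗ[F]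
      block F (sumConj (charTwist (F := F) χ 1)) :=
    { toFun := fun M => ⟨matrixHom χ φ S M, hS.matrixHom_mem_block hχ M⟩
      map_add' := fun M N => Subtype.ext (map_add _ M N)
      map_smul' := fun c M => Subtype.ext (map_smul _ c M) }
  have hΘ : Function.Bijective Θ :=
    ⟨fun M N h => hS.matrixHom_injective hχ (congrArg Subtype.val h), fun x => by
      obtain ⟨M, hM⟩ := hS.exists_matrixHom_eq hχ x.2
      exact ⟨M, Subtype.ext hM⟩⟩
  let Θ' := LinearEquiv.ofBijective Θ hΘ
  have hmul (M N) : Θ' (M * N) = Θ' M * Θ' N := Subtype.ext (hS.matrixHom_mul hχ M N)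
  let ρ := Matrix.reindexAlgEquiv F (CrossedProduct S) (Finite.equivFin (G ⧸ E))
  refine ⟨Θ'.symm.trans ρ.toLinearEquiv, fun a b => ?_⟩
  change ρ (Θ'.symm (a * b)) = ρ (Θ'.symm a) * ρ (Θ'.symm b)
  rw [← map_mul]
  congr 1
  apply Θ'.injective
  rw [hmul]
  simp only [LinearEquiv.apply_symm_apply]

end IsAdapted

end Crossed

/-! ### Values of linear characters on `ε(H, N)`, and characters of finite abelian groups. -/

section Rational

variable {H : Type*} [Group H] [Finite H] {L : Type*} [Field L]

section CharZero

variable [CharZero L]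

open scoped Classical in
theorem lift_hat (ω : H →* L) (M : Subgroup H) :
    MonoidAlgebra.lift ℚ L H ω (hat M) = if M ≤ ω.ker then 1 else 0 := by
  have := Fintype.ofFinite M
  have hM : (Nat.card M : L) ≠ 0 := by exact_mod_cast Nat.card_pos.ne'
  have h1 : ∑ m : M, ω m = if M ≤ ω.ker then (Nat.card M : L) else 0 := by
    have h2 : ω.comp M.subtype = 1 ↔ M ≤ ω.ker := by
      rw [DFunLike.ext_iff, SetLike.le_def]
      exact ⟨fun h x hx => h ⟨x, hx⟩, fun h x => h x.2⟩
    have h3 := sum_hom_units (ω.comp M.subtype)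
    rw [Nat.card_eq_fintype_card, ← if_congr h2 rfl rfl]
    exact h3.trans (Nat.cast_ite ..|>.trans (by rw [Nat.cast_zero]))
  rw [hat, finsum_eq_sum_of_fintype, map_smul, map_sum]
  simp only [MonoidAlgebra.lift_single, one_smul]
  rw [h1]
  split_ifs with h
  · rw [Algebra.smul_def, map_inv₀, map_natCast, inv_mul_cancel₀ hM]
  · rw [smul_zero]

/-- The product of the `1 - M̂` in the definition of `ε(H, N)`. -/
noncomputable def epsFactor (N : Subgroup H) [N.Normal] : MonoidAlgebra ℚ H :=
  ((∏ᶠ M : {M : Subgroup (H ⧸ N) // Minimal (fun S => S.Normal ∧ S ≠ ⊥) M},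
      (1 - hatCenter (M.1.comap (QuotientGroup.mk' N)) (M.2.prop.1.comap _)) :
        Subring.center (MonoidAlgebra ℚ H)) : MonoidAlgebra ℚ H)

theorem eps_eq (N : Subgroup H) [N.Normal] : eps N = epsFactor N * hat N := by
  rw [eps, mul_comm]
  rfl

open scoped Classical in
theorem lift_epsFactor (N : Subgroup H) [N.Normal] (ψ : H ⧸ N →* L) :
    MonoidAlgebra.lift ℚ L H (ψ.comp (QuotientGroup.mk' N)) (epsFactor N) =
      if Function.Injective ψ then 1 else 0 := by
  have := Fintype.ofFinite {M : Subgroup (H ⧸ N) // Minimal (fun S => S.Normal ∧ S ≠ ⊥) M}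
  rw [epsFactor, finprod_eq_prod_of_fintype]
  have h1 := map_prod ((MonoidAlgebra.lift ℚ L H (ψ.comp (QuotientGroup.mk' N)) :
    MonoidAlgebra ℚ H →+* L).comp (Subring.subtype _))
    (fun M : {M : Subgroup (H ⧸ N) // Minimal (fun S => S.Normal ∧ S ≠ ⊥) M} =>
      (1 - hatCenter (M.1.comap (QuotientGroup.mk' N)) (Subgroup.Normal.comap M.2.prop.1 _))) Finset.univ
  refine h1.trans ?_
  have h2 (M : {M : Subgroup (H ⧸ N) // Minimal (fun S => S.Normal ∧ S ≠ ⊥) M}) :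
      ((MonoidAlgebra.lift ℚ L H (ψ.comp (QuotientGroup.mk' N)) :
        MonoidAlgebra ℚ H →+* L).comp (Subring.subtype _))
        (1 - hatCenter (M.1.comap (QuotientGroup.mk' N)) (Subgroup.Normal.comap M.2.prop.1 _)) =
      if M.1 ≤ ψ.ker then 0 else 1 := by
    rw [map_sub, map_one]
    have h3 := lift_hat (ψ.comp (QuotientGroup.mk' N)) (M.1.comap (QuotientGroup.mk' N))
    have h4 : M.1.comap (QuotientGroup.mk' N) ≤ (ψ.comp (QuotientGroup.mk' N)).ker ↔
        M.1 ≤ ψ.ker := by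
      rw [← MonoidHom.comap_ker, Subgroup.comap_le_comap_of_surjective
        (QuotientGroup.mk'_surjective N)]
    rw [if_congr h4 rfl rfl] at h3
    refine (congrArg (1 - ·) h3).trans ?_
    split_ifs <;> simp
  simp only [h2]
  split_ifs with hinj
  · refine Finset.prod_eq_one fun M _ => if_neg fun hM => M.2.prop.2 ?_
    rwa [(MonoidHom.ker_eq_bot_iff ψ).mpr hinj, le_bot_iff] at hM
  -- A nontrivial kernel contains a minimal nontrivial normal subgroup, whose factor `1 - M̂` is
  -- sent to `0`.
  · obtain ⟨M, hM, hmin⟩ := exists_minimal_le_of_wellFoundedLT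
      (fun S : Subgroup (H ⧸ N) => S.Normal ∧ S ≠ ⊥) ψ.ker
      ⟨inferInstance, fun h => hinj ((MonoidHom.ker_eq_bot_iff ψ).mp h)⟩
    exact Finset.prod_eq_zero (Finset.mem_univ ⟨M, hmin⟩) (if_pos hM)

theorem lift_eps_of_injective (N : Subgroup H) [N.Normal] (ψ : H ⧸ N →* L)
    (hψ : Function.Injective ψ) :
    MonoidAlgebra.lift ℚ L H (ψ.comp (QuotientGroup.mk' N)) (eps N) = 1 := by
  classical
  rw [eps_eq, map_mul, lift_epsFactor, if_pos hψ, lift_hat, if_pos, one_mul]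
  intro x hx
  rw [MonoidHom.mem_ker, MonoidHom.comp_apply, QuotientGroup.mk'_apply,
    (QuotientGroup.eq_one_iff x).mpr hx, map_one]

end CharZero

theorem finite_monoidHom_units (Q : Type*) [CommGroup Q] [Finite Q]
    [HasEnoughRootsOfUnity L (Monoid.exponent Q)] : Finite (Q →* Lˣ) :=
  .of_equiv _ (CommGroup.monoidHom_mulEquiv_of_hasEnoughRootsOfUnity Q L).some.symm.toEquiv

theorem sum_monoidHom_units_apply (Q : Type*) [CommGroup Q] [Finite Q]
    [HasEnoughRootsOfUnity L (Monoid.exponent Q)] [Fintype (Q →* Lˣ)] (q : Q)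
    [Decidable (q = 1)] :
    ∑ ψ : Q →* Lˣ, (ψ q : L) = if q = 1 then (Nat.card Q : L) else 0 := by
  classical
  -- Evaluation at `q` is a linear character of the dual group, trivial only for `q = 1`, so the sum
  -- is again an orthogonality relation.
  let f : (Q →* Lˣ) →* L := (Units.coeHom L).comp (MonoidHom.eval q)
  have hf : f = 1 ↔ q = 1 := by
    constructor
    · intro h
      by_contra hq
      obtain ⟨ψ, hψ⟩ := CommGroup.exists_apply_ne_one_of_hasEnoughRootsOfUnity Q L hq
      exact hψ (Units.ext (DFunLike.congr_fun h ψ))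
    · rintro rfl
      ext ψ
      simp [f]
  have := sum_hom_units f
  rw [← Nat.card_eq_fintype_card, CommGroup.card_monoidHom_of_hasEnoughRootsOfUnity,
    if_congr hf rfl rfl] at this
  exact this.trans (Nat.cast_ite ..|>.trans (by rw [Nat.cast_zero]))

end Rational

/-! ### Decomposing `ε(H, K)` over `F`. -/

section BaseChange

variable {G : Type*} [Group G] [Finite G] {F : Type*} [Field F] [CharZero F] {L : Type*} [Field L]
  [CharZero L] [Algebra F L] {H : Subgroup G}

/-- The inclusion of the rational group algebra of a subgroup in the group algebra over `F`. -/
noncomputable def baseChange (F : Type*) [Field F] [CharZero F] (H : Subgroup G) :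
    MonoidAlgebra ℚ H →+* MonoidAlgebra F G :=
  (mapRingHom G (algebraMap ℚ F)).comp (mapDomainRingHom ℚ H.subtype)

omit [Finite G] in
theorem baseChange_single (h : H) (c : ℚ) :
    baseChange F H (MonoidAlgebra.single h c) = MonoidAlgebra.single (h : G) (c : F) := by
  simp [baseChange]

omit [Finite G] in
theorem baseChange_smul (c : ℚ) (x : MonoidAlgebra ℚ H) :
    baseChange F H (c • x) = (c : F) • baseChange F H x := by
  induction x using MonoidAlgebra.induction_linear with
  | zero => simp
  | add x y hx hy => rw [smul_add, map_add, map_add, smul_add, hx, hy]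
  | single h r => simp [baseChange_single, smul_single]

theorem baseChange_mul_charTwist (ω : H →* L) (x : MonoidAlgebra ℚ H) (r : L) :
    baseChange F H x * charTwist ω r = charTwist ω (MonoidAlgebra.lift ℚ L H ω x * r) := by
  induction x using MonoidAlgebra.induction_on with
  | of h =>
    rw [of_apply, baseChange_single, MonoidAlgebra.lift_single, one_smul, Rat.cast_one,
      ← of_mul_charTwist, of_apply]
  | add x y hx hy => rw [map_add, map_add, add_mul, add_mul, map_add, hx, hy]
  | smul c x hx =>
    rw [baseChange_smul, smul_mul_assoc, hx, map_smul, smul_mul_assoc, ← map_smul]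
    congr 1
    simp [Algebra.smul_def]

theorem charTwist_mul_baseChange (ω : H →* L) (x : MonoidAlgebra ℚ H) (r : L) :
    charTwist ω r * baseChange F H x = charTwist ω (MonoidAlgebra.lift ℚ L H ω x * r) := by
  induction x using MonoidAlgebra.induction_on with
  | of h =>
    rw [of_apply, baseChange_single, MonoidAlgebra.lift_single, one_smul, Rat.cast_one,
      ← charTwist_mul_of, of_apply]
  | add x y hx hy => rw [map_add, map_add, mul_add, add_mul, map_add, hx, hy]
  | smul c x hx =>
    rw [baseChange_smul, mul_smul_comm, hx, map_smul, smul_mul_assoc, ← map_smul]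
    congr 1
    simp [Algebra.smul_def]

/-- The character of `H` obtained from a character of a quotient of `H` with values in the units
of `L`. -/
noncomputable def inflate {N : Subgroup H} [N.Normal] (ψ : H ⧸ N →* Lˣ) : H →* L :=
  ((Units.coeHom L).comp ψ).comp (QuotientGroup.mk' N)

omit [CharZero L] in
-- Column orthogonality for the characters of `H/N`. The factor `[L:F]` is the trace of `1`: the sum
-- is over characters rather than Galois orbits.
theorem finrank_smul_baseChange_hat (N : Subgroup H) [N.Normal] [IsCyclic (H ⧸ N)]
    [FiniteDimensional F L]
    [HasEnoughRootsOfUnity L (Nat.card (H ⧸ N))] [Fintype (H ⧸ N →* Lˣ)] :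
    (Module.finrank F L : F) • baseChange F H (hat N) =
      ∑ ψ : H ⧸ N →* Lˣ, charTwist (F := F) (inflate ψ) 1 := by
  classical
  have := Fintype.ofFinite H
  have := Fintype.ofFinite N
  let : CommGroup (H ⧸ N) := IsCyclic.commGroup
  have : HasEnoughRootsOfUnity L (Monoid.exponent (H ⧸ N)) := by
    rwa [IsCyclic.exponent_eq_card]
  have key (h : H) : ∑ ψ : H ⧸ N →* Lˣ, Algebra.trace F L (inflate ψ h) =
      if h ∈ N then (Nat.card (H ⧸ N) : F) * Module.finrank F L else 0 := by
    rw [← map_sum]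
    have h1 := (sum_monoidHom_units_apply (L := L) (H ⧸ N) (h : H ⧸ N)).trans
      (if_congr (QuotientGroup.eq_one_iff h) rfl rfl)
    refine (congrArg (Algebra.trace F L) h1).trans ?_
    split_ifs
    · rw [← map_natCast (algebraMap F L), Algebra.trace_algebraMap, nsmul_eq_mul, mul_comm]
    · rw [map_zero]
  have hcard : Nat.card H = Nat.card (H ⧸ N) * Nat.card N := N.card_eq_card_quotient_mul_card_subgroup
  have hQ : (Nat.card (H ⧸ N) : F) ≠ 0 := by exact_mod_cast Nat.card_pos.ne'
  have hN : (Nat.card N : F) ≠ 0 := by exact_mod_cast Nat.card_pos.ne'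
  simp only [charTwist_apply, one_mul]
  rw [← Finset.smul_sum, Finset.sum_comm]
  have h3 (h : H) : ∑ ψ : H ⧸ N →* Lˣ, MonoidAlgebra.single (h : G)⁻¹
      (Algebra.trace F L (inflate ψ h)) =
      if h ∈ N then MonoidAlgebra.single (h : G)⁻¹ ((Nat.card (H ⧸ N) : F) * Module.finrank F L)
        else 0 := by
    refine (map_sum (singleAddHom (R := F) (h : G)⁻¹) _ Finset.univ).symm.trans ?_
    rw [key]
    split_ifs
    · rfl
    · rw [map_zero]
  simp only [h3]
  rw [← Finset.sum_filter, Finset.sum_subtype (p := fun h => h ∈ N) _ (by simp)]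
  rw [hat, finsum_eq_sum_of_fintype, baseChange_smul, map_sum]
  simp only [baseChange_single, Rat.cast_one]
  rw [← Equiv.sum_comp (Equiv.inv N)]
  simp only [Finset.smul_sum, smul_single, Equiv.inv_apply, InvMemClass.coe_inv]
  refine Finset.sum_congr rfl fun n _ => ?_
  congr 1
  rw [hcard]
  push_cast
  simp only [smul_eq_mul]
  field_simp

/-- Multiplying the decomposition of `N̂` by the remaining factor of `ε(H, N)` keeps exactly the
terms of the faithful characters, so an `x` annihilating these annihilates `ε(H, N)`. -/
theorem mul_baseChange_eps_eq_zero (N : Subgroup H) [N.Normal] [IsCyclic (H ⧸ N)]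
    [FiniteDimensional F L] [HasEnoughRootsOfUnity L (Nat.card (H ⧸ N))] {x : MonoidAlgebra F G}
    (hx : ∀ ψ : H ⧸ N →* L, Function.Injective ψ →
      x * charTwist (ψ.comp (QuotientGroup.mk' N)) 1 = 0) :
    x * baseChange F H (eps N) = 0 := by
  classical
  have : HasEnoughRootsOfUnity L (Monoid.exponent (H ⧸ N)) := by
    rwa [IsCyclic.exponent_eq_card]
  let : CommGroup (H ⧸ N) := IsCyclic.commGroup
  have := finite_monoidHom_units (L := L) (H ⧸ N)
  have := Fintype.ofFinite (H ⧸ N →* Lˣ)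
  have hd : (Module.finrank F L : F) ≠ 0 := by exact_mod_cast Module.finrank_pos.ne'
  have h1 : (Module.finrank F L : F) • (x * baseChange F H (eps N)) = 0 := by
    rw [eps_eq, map_mul, ← mul_smul_comm, ← mul_smul_comm, finrank_smul_baseChange_hat (L := L),
      Finset.mul_sum, Finset.mul_sum]
    refine Finset.sum_eq_zero fun ψ _ => ?_
    rw [baseChange_mul_charTwist, inflate, lift_epsFactor]
    split_ifs with hψ
    · rw [one_mul, hx _ hψ]
    · rw [zero_mul, map_zero, mul_zero]
  exact (smul_eq_zero.mp h1).resolve_left hd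

end BaseChange

/-! ### Primitive central idempotents in general. -/

section Primitive

variable {A : Type*} [Ring A]

/-- Apply primitivity to `e = e f + e (1 - f)`. -/
theorem IsPrimitiveCentralIdempotent.mul_eq_self {e f : A} (he : IsPrimitiveCentralIdempotent e)
    (hf : IsIdempotentElem f) (hfc : f ∈ Subring.center A) (h : e * f ≠ 0) : e * f = e := by
  have hc := Subring.mem_center_iff.mp hfc
  have h1 : IsIdempotentElem (e * f) := he.idem.mul_of_commute (hc e) hf
  have h2 : IsIdempotentElem (e * (1 - f)) :=
    he.idem.mul_of_commute (by rw [Commute, SemiconjBy, mul_sub, sub_mul, hc e, mul_one, one_mul])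
      hf.one_sub
  have h3 := he.primitive (e * f) (e * (1 - f)) h1 h2 (mul_mem he.central hfc)
    (mul_mem he.central (sub_mem (one_mem _) hfc))
    (by rw [mul_assoc, ← mul_assoc f, ← hc e, mul_assoc, mul_sub, mul_one, hf.eq, sub_self,
      mul_zero, mul_zero])
    (by rw [← mul_add, add_sub_cancel, mul_one])
  have h4 := h3.resolve_left h
  rw [mul_sub, mul_one, sub_eq_zero] at h4
  exact h4.symm

theorem IsPrimitiveCentralIdempotent.eq_of_mul_ne_zero {e f : A}
    (he : IsPrimitiveCentralIdempotent e) (hf : IsPrimitiveCentralIdempotent f) (h : e * f ≠ 0) :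
    e = f := by
  have h1 := he.mul_eq_self hf.idem hf.central h
  rw [← h1, Subring.mem_center_iff.mp hf.central, hf.mul_eq_self he.idem he.central]
  rwa [← Subring.mem_center_iff.mp hf.central]

/-- A finite-dimensional algebra has enough primitive central idempotents to detect nonvanishing
under a ring homomorphism. -/
theorem exists_isPrimitiveCentralIdempotent (K : Type*) [Field K] [Algebra K A]
    [FiniteDimensional K A] {B : Type*} [Ring B] (ι : A →+* B) {e : B} (he : e ≠ 0) :
    ∃ f : A, IsPrimitiveCentralIdempotent f ∧ e * ι f ≠ 0 := by
  let S : Set A := {f | IsIdempotentElem f ∧ f ∈ Subring.center A ∧ e * ι f ≠ 0}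
  have hS : S.Nonempty := ⟨1, IsIdempotentElem.one, one_mem _, by rwa [map_one, mul_one]⟩
  let d : A → ℕ := fun f => Module.finrank K (LinearMap.range (LinearMap.mulLeft K f))
  -- Among the central idempotents not killed by `e`, take `f` with `f A` of least dimension. If `f
  -- = f₁ + f₂` and `e` does not kill `f₁`, then `f₁ A = f A` contains `f₂`, which forces `f₂ = f₁
  -- f₂ = 0`.
  obtain ⟨f, ⟨hf, hfc, hef⟩, hmin⟩ := WellFounded.has_min (InvImage.wf d wellFounded_lt) S hS
  have aux (f₁ f₂ : A) (h₁ : IsIdempotentElem f₁)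
      (h₂ : IsIdempotentElem f₂) (hc₁ : f₁ ∈ Subring.center A)
      (h0 : f₁ * f₂ = 0) (h : f = f₁ + f₂) (he₁ : e * ι f₁ ≠ 0) : f₂ = 0 := by
    have hff₁ : f * f₁ = f₁ := by
      rw [h, add_mul, h₁.eq, Subring.mem_center_iff.mp hc₁ f₂, h0, add_zero]
    have hle : LinearMap.range (LinearMap.mulLeft K f₁) ≤ LinearMap.range (LinearMap.mulLeft K f) := by
      rintro _ ⟨x, rfl⟩
      exact ⟨f₁ * x, by simp [← mul_assoc, hff₁]⟩
    have heq := Submodule.eq_of_le_of_finrank_le hle (not_lt.mp (hmin f₁ ⟨h₁, hc₁, he₁⟩))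
    have hmem : f₂ ∈ LinearMap.range (LinearMap.mulLeft K f₁) := by
      rw [heq]
      exact ⟨f₂, by rw [LinearMap.mulLeft_apply, h, add_mul, h0, h₂.eq, zero_add]⟩
    obtain ⟨x, hx⟩ := hmem
    rw [LinearMap.mulLeft_apply] at hx
    rw [← hx, ← h₁.eq, mul_assoc, hx, h0]
  refine ⟨f, ⟨hf, hfc, ?_, ?_⟩, hef⟩
  · rintro rfl
    simp at hef
  · intro f₁ f₂ h₁ h₂ hc₁ hc₂ h0 h
    by_cases he₁ : e * ι f₁ = 0
    · left
      refine aux f₂ f₁ h₂ h₁ hc₂ ?_ (by rw [h, add_comm]) ?_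
      · rw [Subring.mem_center_iff.mp hc₁, h0]
      · rwa [h, map_add, mul_add, he₁, zero_add] at hef
    · exact .inr (aux f₁ f₂ h₁ h₂ hc₁ h0 h he₁)

end Primitive

/-! ### The field `F(ζ_k)` and its Galois group. -/

section Cyclotomic

variable (F : Type*) [Field F] [Algebra F ℂ] (k : ℕ) [NeZero k]

theorem cycloField_isCyclotomicExtension : IsCyclotomicExtension {k} F (CycloField F k) := by
  have h : IsPrimitiveRoot (zetaC k) k := Complex.isPrimitiveRoot_exp k (NeZero.ne k)
  change IsCyclotomicExtension {k} F (CycloField F k).toSubalgebra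
  rw [IntermediateField.adjoin_simple_toSubalgebra_of_isAlgebraic]
  · exact h.adjoin_isCyclotomicExtension F
  · exact (h.isIntegral (NeZero.pos k)).tower_top.isAlgebraic

instance : FiniteDimensional F (CycloField F k) :=
  have := cycloField_isCyclotomicExtension F k
  IsCyclotomicExtension.finiteDimensional {k} F _

instance [CharZero F] : IsGalois F (CycloField F k) :=
  have := cycloField_isCyclotomicExtension F k
  IsCyclotomicExtension.isGalois {k} F _

instance : HasEnoughRootsOfUnity (CycloField F k) k where
  prim := ⟨_, zeta_isPrimitiveRoot F k⟩
  cyc := inferInstance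

variable {F k}

theorem cycloField_algEquiv_ext {s t : CycloField F k ≃ₐ[F] CycloField F k}
    (h : s (zeta F k) = t (zeta F k)) : s = t := by
  have := cycloField_isCyclotomicExtension F k
  apply IsPrimitiveRoot.autToPow_injective (K := F) (zeta_isPrimitiveRoot F k)
  have hp := zeta_isPrimitiveRoot F k
  refine Units.ext (ZMod.val_injective k (hp.pow_inj (ZMod.val_lt _) (ZMod.val_lt _) ?_))
  rw [hp.autToPow_spec F s, hp.autToPow_spec F t, h]

end Cyclotomic

/-! ### Faithful characters of cyclic groups. -/

section FaithfulChar

variable {F : Type*} [Field F] [Algebra F ℂ] {Q : Type*} [Group Q] [Finite Q]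

instance : NeZero (Nat.card Q) := ⟨Nat.card_pos.ne'⟩

namespace FaithfulChar

variable (χ : FaithfulChar F Q)

theorem exists_apply_eq_zeta [IsCyclic Q] : ∃ y, χ.1 y = zeta F (Nat.card Q) := by
  obtain ⟨g, hg⟩ := IsCyclic.exists_ofOrder_eq_natCard (α := Q)
  have h1 : IsPrimitiveRoot (χ.1 g) (Nat.card Q) := by
    have h := IsPrimitiveRoot.orderOf (χ.1 g)
    rwa [orderOf_injective χ.1 χ.2 g, hg] at h
  obtain ⟨i, -, hi⟩ := h1.eq_pow_of_pow_eq_one (zeta_isPrimitiveRoot F (Nat.card Q)).pow_eq_one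
  exact ⟨g ^ i, by rw [map_pow, hi]⟩

theorem exists_eq_zeta_pow (q : Q) : ∃ i : ℕ, χ.1 q = zeta F (Nat.card Q) ^ i := by
  obtain ⟨i, -, hi⟩ := (zeta_isPrimitiveRoot F (Nat.card Q)).eq_pow_of_pow_eq_one (ξ := χ.1 q)
    (by rw [← map_pow, pow_card_eq_one', map_one])
  exact ⟨i, hi.symm⟩

theorem exists_eq_zpow {y : Q} (hy : χ.1 y = zeta F (Nat.card Q)) (q : Q) :
    ∃ i : ℤ, q = y ^ i := by
  obtain ⟨i, hi⟩ := χ.exists_eq_zeta_pow q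
  exact ⟨i, χ.2 (by rw [hi, zpow_natCast, map_pow, hy])⟩

theorem galois_apply (s : CycloField F (Nat.card Q) ≃ₐ[F] CycloField F (Nat.card Q)) (q : Q) :
    s (χ.1 q) = χ.1 q ^
      (((zeta_isPrimitiveRoot F (Nat.card Q)).autToPow F s : (ZMod (Nat.card Q))ˣ) :
        ZMod (Nat.card Q)).val := by
  obtain ⟨i, hi⟩ := χ.exists_eq_zeta_pow q
  rw [hi, map_pow, ← (zeta_isPrimitiveRoot F (Nat.card Q)).autToPow_spec F s, pow_right_comm]

end FaithfulChar

end FaithfulChar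

theorem exists_conj_equiv {G : Type*} [Group G] {H : Subgroup G} {g : G}
    (hg : g ∈ Subgroup.normalizer (H : Set G)) : ∃ e : H ≃ H, ∀ h, (e h : G) = g⁻¹ * h * g :=
  ⟨{ toFun := fun h => ⟨g⁻¹ * h * g, (Subgroup.mem_normalizer_iff''.mp hg _).mp h.2⟩
     invFun := fun h => ⟨g * h * g⁻¹, (Subgroup.mem_normalizer_iff.mp hg _).mp h.2⟩
     left_inv := fun h => Subtype.ext (by simp [mul_assoc])
     right_inv := fun h => Subtype.ext (by simp [mul_assoc]) }, fun _ => rfl⟩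

/-! ### Inflated characters and their stabilizer. -/

namespace CyclicSection

variable {G : Type*} [Group G] [Finite G] {F : Type*} [Field F] [Algebra F ℂ]
  (P : CyclicSection G)

variable {P} in
/-- The character of `H` obtained from a character of `H / K`. -/
noncomputable def inflateChar (χ : FaithfulChar F P.Q) : P.H →* CycloField F (Nat.card P.Q) :=
  χ.1.comp (QuotientGroup.mk' _)

omit [Finite G] in
theorem inflateChar_apply (χ : FaithfulChar F P.Q) (h : P.H) :
    inflateChar χ h = χ.1 (QuotientGroup.mk h) := rfl

theorem epsChar_eq_charTwist (χ : FaithfulChar F P.Q) :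
    P.epsChar F χ = charTwist (inflateChar χ) 1 := by
  change _ = (Nat.card P.H : F)⁻¹ • ∑ᶠ h : P.H, MonoidAlgebra.single (h : G)⁻¹
    (Algebra.trace F _ (1 * inflateChar χ h))
  simp only [one_mul]
  rfl

theorem eC_mk (χ : FaithfulChar F P.Q) :
    P.eC (Quotient.mk (faithfulCharSetoid F P.Q) χ) = sumConj (charTwist (inflateChar χ) 1) := by
  rw [← epsChar_eq_charTwist]
  rfl

/-- The generator `ζ_k` of the field is itself a value of `χ`. -/
theorem isSeparating (χ : FaithfulChar F P.Q) : IsSeparating F (inflateChar χ) := by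
  intro s t hst
  obtain ⟨y, hy⟩ := χ.exists_apply_eq_zeta
  obtain ⟨h, rfl⟩ := QuotientGroup.mk_surjective y
  apply cycloField_algEquiv_ext
  rw [← hy]
  exact hst h

variable {P} in
-- A Galois automorphism acts on the values of `χ` as a power map with exponent in `I_k(F)`, and
-- faithfulness of `χ` transfers equalities of values back to `H/K`.
theorem mem_E_iff (χ : FaithfulChar F P.Q) {g : G} : g ∈ P.E F ↔
    g ∈ Subgroup.normalizer (P.H : Set G) ∧ g ∈ Subgroup.normalizer (P.K : Set G) ∧
      ∃ s : CycloField F (Nat.card P.Q) ≃ₐ[F] CycloField F (Nat.card P.Q),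
        ∀ h h' : P.H, (h' : G) = g⁻¹ * h * g → inflateChar χ h' = s (inflateChar χ h) := by
  refine and_congr_right fun _ => and_congr_right fun _ => ?_
  constructor
  · rintro ⟨_, ⟨s, rfl⟩, hs⟩
    refine ⟨s, fun h h' hh => ?_⟩
    refine Eq.trans ?_ (χ.galois_apply s _).symm
    rw [inflateChar_apply, hs h h' hh, map_pow]
    rfl
  · rintro ⟨s, hs⟩
    refine ⟨_, ⟨s, rfl⟩, fun h h' hh => χ.2 ?_⟩
    rw [map_pow]
    exact (hs h h' hh).trans (χ.galois_apply s _)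

end CyclicSection

/-! ### Strong Shoda pairs. -/

namespace StrongShodaPair

open CyclicSection

variable {G : Type*} [Group G] [Finite G] {F : Type*} [Field F] [CharZero F] [Algebra F ℂ]
  (P : StrongShodaPair G)

theorem baseChange_eps_mul (χ : FaithfulChar F P.Q) (r : CycloField F (Nat.card P.Q)) :
    baseChange F P.H (GroupAlgebraIdempotents.eps (P.K.subgroupOf P.H)) *
      charTwist (inflateChar χ) r = charTwist (inflateChar χ) r := by
  rw [baseChange_mul_charTwist, inflateChar, lift_eps_of_injective _ _ χ.2, one_mul]

theorem mul_baseChange_eps (χ : FaithfulChar F P.Q) (r : CycloField F (Nat.card P.Q)) :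
    charTwist (inflateChar χ) r *
      baseChange F P.H (GroupAlgebraIdempotents.eps (P.K.subgroupOf P.H)) =
      charTwist (inflateChar χ) r := by
  rw [charTwist_mul_baseChange, inflateChar, lift_eps_of_injective _ _ χ.2, one_mul]

omit [Algebra F ℂ] in
theorem baseChange_eps_eq : baseChange F P.H (GroupAlgebraIdempotents.eps (P.K.subgroupOf P.H)) =
    mapRingHom G (algebraMap ℚ F) P.eps := rfl

omit [Algebra F ℂ] in
theorem baseChange_eps_mul_of_mul {g : G} (hg : g ∉ Subgroup.normalizer (P.K : Set G)) :
    mapRingHom G (algebraMap ℚ F) P.eps * of F G g * mapRingHom G (algebraMap ℚ F) P.eps = 0 := by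
  have h1 := P.eps_mul_conj g⁻¹ (fun h => hg (inv_mem_iff.mp h))
  rw [conj_def, inv_inv, ← mul_assoc, ← mul_assoc] at h1
  have h2 : P.eps * of ℚ G g * P.eps = 0 := by
    have h3 := congrArg (· * of ℚ G g) h1
    simpa only [mul_assoc, of_inv_mul_of, mul_one, zero_mul] using h3
  have h4 := congrArg (mapRingHom G (algebraMap ℚ F)) h2
  rw [map_mul, map_mul, map_zero, of_apply, mapRingHom_single, map_one] at h4
  exact h4

/-- Adjoining to `H/K` an element centralizing it generates an abelian group, so by maximality
nothing new is added. -/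
theorem mem_of_commute {g : G} (hg : g ∈ Subgroup.normalizer (P.K : Set G))
    (hc : ∀ h h' : P.H, (h' : G) = g⁻¹ * h * g →
      (QuotientGroup.mk h' : P.Q) = QuotientGroup.mk h) : g ∈ P.H := by
  let N := Subgroup.normalizer (P.K : Set G)
  let g' : N := ⟨g, hg⟩
  let A := (P.H.subgroupOf N).map (QuotientGroup.mk' (P.K.subgroupOf N))
  have hA : IsMulCommutative A := P.maximal_abelian.prop
  have hH : g ∈ Subgroup.normalizer (P.H : Set G) :=
    (Subgroup.normal_subgroupOf_iff_le_normalizer P.H_le_normalizer).mp P.H_normal hg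
  have hgA : ∀ a ∈ A, (g' : N ⧸ P.K.subgroupOf N) * a = a * g' := by
    rintro _ ⟨h, hh, rfl⟩
    have h1 : g⁻¹ * h * g ∈ P.H := (Subgroup.mem_normalizer_iff''.mp hH _).mp hh
    have h2 := QuotientGroup.eq.mp (hc ⟨h, hh⟩ ⟨_, h1⟩ rfl).symm
    refine QuotientGroup.eq.mpr ?_
    have h3 : (g' * h)⁻¹ * (h * g') = h⁻¹ * (g'⁻¹ * h * g') := by group
    rw [h3]
    exact h2
  have hcomm : ∀ x ∈ insert (g' : N ⧸ P.K.subgroupOf N) (A : Set (N ⧸ P.K.subgroupOf N)),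
      ∀ y ∈ insert (g' : N ⧸ P.K.subgroupOf N) (A : Set (N ⧸ P.K.subgroupOf N)),
        x * y = y * x := by
    rintro x (rfl | hx) y (rfl | hy)
    · rfl
    · exact hgA y hy
    · exact (hgA x hx).symm
    · exact congrArg Subtype.val (hA.is_comm.comm (⟨x, hx⟩ : A) ⟨y, hy⟩)
  have hle := P.maximal_abelian.le_of_ge (Subgroup.isMulCommutative_closure hcomm)
    ((Set.subset_insert _ _).trans Subgroup.subset_closure)
  obtain ⟨h, hh, hgh⟩ := hle (Subgroup.subset_closure (Set.mem_insert _ _))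
  have h4 : h⁻¹ * g' ∈ P.K.subgroupOf N := QuotientGroup.eq.mp hgh
  have h5 : (h : G) * ((h : G)⁻¹ * g) ∈ P.H := mul_mem hh (P.K_le_H h4)
  rwa [mul_inv_cancel_left] at h5

theorem isStableChar (χ : FaithfulChar F P.Q) :
    IsStableChar F (inflateChar χ) (P.E F) where
  le := P.H_le_E F
  sep := P.isSeparating χ
  act g hg := by
    obtain ⟨h1, -, s, hs⟩ := (mem_E_iff χ).mp hg
    obtain ⟨e, he⟩ := exists_conj_equiv h1
    exact ⟨e, s, he, fun h => hs h _ (he h)⟩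
  orth g hg := by
    by_cases hK : g ∈ Subgroup.normalizer (P.K : Set G)
    · have hH : g ∈ Subgroup.normalizer (P.H : Set G) :=
        (Subgroup.normal_subgroupOf_iff_le_normalizer P.H_le_normalizer).mp P.H_normal hK
      obtain ⟨e, he⟩ := exists_conj_equiv hH
      have hmul (a b : P.H) : e (a * b) = e a * e b := Subtype.ext (by simp [he, mul_assoc])
      let e' : P.H ≃* P.H := ⟨e, hmul⟩
      -- `g⁻¹ ε g` is the idempotent of the conjugate character `ψ`. Were `ψ` Galois conjugate to
      -- `χ`, then `g` would lie in `E`; hence the two idempotents are orthogonal.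
      let ψ : P.H →* CycloField F (Nat.card P.Q) := (inflateChar χ).comp e'.symm.toMonoidHom
      have h1 := of_mul_charTwist_mul_of (F := F) (inflateChar χ) ψ g e he AlgEquiv.refl
        (fun h => congrArg (inflateChar χ) (e'.symm_apply_apply h)) 1
      have h2 : charTwist (F := F) (inflateChar χ) 1 * of F G g = of F G g * charTwist ψ 1 := by
        rw [AlgEquiv.coe_refl, id] at h1
        rw [← h1, ← mul_assoc, ← mul_assoc, of_mul_of_inv, one_mul]
      rw [h2, mul_assoc, charTwist_mul_eq_zero, mul_zero]
      intro s
      by_contra! hs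
      refine hg ((mem_E_iff χ).mpr ⟨hH, hK, s, fun h h' hh => ?_⟩)
      obtain rfl : h' = e h := Subtype.ext (hh.trans (he h).symm)
      rw [← hs]
      exact congrArg (fun x => s (inflateChar χ x)) (e'.symm_apply_apply h)
    · have h1 := P.baseChange_eps_mul_of_mul (F := F) hK
      rw [← baseChange_eps_eq] at h1
      rw [← P.baseChange_eps_mul χ 1]
      -- Absorb `ε(H, K)` on the inner side of both copies of `ε`, so that `ε(H, K) g ε(H, K) = 0`
      -- appears in the middle.
      conv_lhs => enter [1, 1]; rw [P.baseChange_eps_mul, ← P.mul_baseChange_eps χ 1]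
      rw [← mul_assoc, mul_assoc _ _ (of F G g), mul_assoc (charTwist _ _) _ (baseChange _ _ _), h1,
        mul_zero, zero_mul]
  faithful g hg hc :=
    P.mem_of_commute ((mem_E_iff χ).mp hg).2.1 fun h h' hh => χ.2 (hc h h' hh)

theorem exists_crossedSystem (χ : FaithfulChar F P.Q) (φ : P.EmodH F → P.EmodK F)
    (hφ : ∀ q, P.proj F (φ q) = q) (y : P.Q) (hy : χ.1 y = zeta F P.k) :
    ∃ S : CrossedSystem F (CycloField F P.k) (P.EmodH F),
      (∀ q, ∃ i : ℤ, (φ q)⁻¹ * P.incl F y * φ q = P.incl F y ^ i ∧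
        S.σ q (zeta F P.k) = zeta F P.k ^ i) ∧
      (∀ q q', ∃ j : ℤ, (φ (q * q'))⁻¹ * φ q * φ q' = P.incl F y ^ j ∧
        (S.τ q q' : CycloField F P.k) = zeta F P.k ^ j) ∧
      ∃ f : block F (sumConj (charTwist (F := F) (inflateChar χ) 1)) ≃ₗ[F]
          Matrix (Fin (P.E F).index) (Fin (P.E F).index) (CrossedProduct S),
        ∀ a b, f (a * b) = f a * f b := by
  have hχ := P.isStableChar χ
  have := Fintype.ofFinite (G ⧸ P.E F)
  -- The section takes values in `E/K`, whereas group elements are needed in `E`; the choice of lift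
  -- is harmless because `χ` is trivial on `K`.
  choose φ' hφ' using fun q => QuotientGroup.mk_surjective (φ q)
  have hsec (q) : (φ' q : P.EmodH F) = q := by
    conv_rhs => rw [← hφ q, ← hφ' q]
    rfl
  obtain ⟨S, hS⟩ := hχ.exists_isAdapted φ' hsec
  have hζ (i : ℤ) : χ.1 (y ^ i) = zeta F P.k ^ i := by
    rw [← hy]
    exact map_zpow χ.1 y i
  refine ⟨S, fun q => ?_, fun q q' => ?_, hS.exists_equiv_block hχ⟩
  · obtain ⟨h, rfl⟩ := QuotientGroup.mk_surjective y
    have hm : ((φ' q : G))⁻¹ * h * φ' q ∈ P.H :=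
      (Subgroup.mem_normalizer_iff''.mp (φ' q).2.1 _).mp h.2
    obtain ⟨i, hi⟩ := χ.exists_eq_zpow hy (QuotientGroup.mk ⟨_, hm⟩)
    refine ⟨i, ?_, ?_⟩
    · rw [← map_zpow, ← hi, ← hφ']
      rfl
    · rw [← hζ, ← hi, ← hy]
      exact (hS.σ_eq q h ⟨_, hm⟩ rfl).symm
  · have hm := inv_mul_mem_of_section hsec q q'
    obtain ⟨j, hj⟩ := χ.exists_eq_zpow hy (QuotientGroup.mk ⟨_, hm⟩)
    refine ⟨j, ?_, ?_⟩
    · rw [← map_zpow, ← hj, ← hφ', ← hφ', ← hφ']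
      rfl
    · rw [← hζ, ← hj]
      exact (hS.τ_eq q q' ⟨_, hm⟩ rfl).symm

omit [Algebra F ℂ] in
theorem mul_baseChange_conj_eps_eq_zero {e : MonoidAlgebra F G}
    (he : e ∈ Subring.center (MonoidAlgebra F G))
    (h : e * mapRingHom G (algebraMap ℚ F) P.eps = 0) (g : G) :
    e * mapRingHom G (algebraMap ℚ F) (conj P.eps g) = 0 := by
  rw [conj_def, map_mul, map_mul, ← mul_assoc, ← mul_assoc, ← Subring.mem_center_iff.mp he,
    mul_assoc _ e, h, mul_zero, zero_mul]

/-- A central element killing `ε(H, K)` kills all its conjugates, so `e` does not kill `ε(H, K)`,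
nor therefore some `charTwist χ 1`; then `e` and the corresponding `e_C` have nonzero product and
are equal. -/
theorem exists_eq_eC {e : MonoidAlgebra F G} (he : IsPrimitiveCentralIdempotent e)
    (h : e * mapRingHom G (algebraMap ℚ F) P.e ≠ 0) :
    ∃ C : CharClass F P.Q, e = P.eC C := by
  have h1 : e * mapRingHom G (algebraMap ℚ F) P.eps ≠ 0 := by
    intro h0
    apply h
    refine finsum_mem_induction (fun x => e * mapRingHom G (algebraMap ℚ F) x = 0) ?_ ?_ ?_
    · rw [map_zero, mul_zero]
    · intro x y hx hy
      rw [map_add, mul_add, hx, hy, add_zero]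
    · rintro _ ⟨g, rfl⟩
      exact P.mul_baseChange_conj_eps_eq_zero he.central h0 g
  have h2 : ∃ χ : FaithfulChar F P.Q, e * charTwist (inflateChar χ) 1 ≠ 0 := by
    by_contra! h0
    exact h1 (mul_baseChange_eps_eq_zero (L := CycloField F (Nat.card P.Q)) (P.K.subgroupOf P.H)
      fun ψ hψ => h0 ⟨ψ, hψ⟩)
  obtain ⟨χ, hχ⟩ := h2
  have hs := P.isStableChar χ
  refine ⟨Quotient.mk _ χ, ?_⟩
  rw [eC_mk]
  refine he.eq_of_mul_ne_zero hs.isPrimitiveCentralIdempotent fun h0 => hχ ?_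
  rw [← hs.sumConj_mul, ← mul_assoc, h0, zero_mul]

end StrongShodaPair

end GroupAlgebraIdempotents

theorem mainTheorem1 {G : Type*} [Group G] [Finite G]
    {F : Type*} [Field F] [NumberField F] [Algebra F ℂ] :
    (∀ (P : StrongShodaPair G) (C : CharClass F P.Q),
      IsPrimitiveCentralIdempotent (P.eC C) ∧
      ∀ φ : P.EmodH F → P.EmodK F, (∀ q, P.proj F (φ q) = q) →
      ∀ χ : FaithfulChar F P.Q, Quotient.mk (faithfulCharSetoid F P.Q) χ = C →
      ∀ y : P.Q, χ.1 y = zeta F P.k →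
      ∃ S : CrossedSystem F (CycloField F P.k) (P.EmodH F),
        (∀ q, ∃ i : ℤ, (φ q)⁻¹ * P.incl F y * φ q = P.incl F y ^ i ∧
          S.σ q (zeta F P.k) = zeta F P.k ^ i) ∧
        (∀ q q', ∃ j : ℤ, (φ (q * q'))⁻¹ * φ q * φ q' = P.incl F y ^ j ∧
          (S.τ q q' : CycloField F P.k) = zeta F P.k ^ j) ∧
        ∃ f : block F (P.eC C) ≃ₗ[F]
            Matrix (Fin (P.E F).index) (Fin (P.E F).index) (CrossedProduct S),
          ∀ a b, f (a * b) = f a * f b) ∧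
    (∀ X : Set (StrongShodaPair G),
      (∀ e : MonoidAlgebra ℚ G, IsPrimitiveCentralIdempotent e → ∃ P ∈ X, e = P.e) →
      ∀ e : MonoidAlgebra F G, IsPrimitiveCentralIdempotent e →
        ∃ P ∈ X, ∃ C : CharClass F P.Q, e = P.eC C) := by
  refine ⟨fun P C => ?_, fun X hX e he => ?_⟩
  · induction C using Quotient.ind with
    | _ χ₀ =>
      refine ⟨?_, fun φ hφ χ hχ y hy => ?_⟩
      · rw [CyclicSection.eC_mk]
        exact (P.isStableChar χ₀).isPrimitiveCentralIdempotent
      · rw [← hχ, CyclicSection.eC_mk]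
        exact P.exists_crossedSystem χ φ hφ y hy
  -- The image of `f` in `FG` need not be primitive; only its nonzero product with `e` is used.
  · obtain ⟨f, hf, hne⟩ := exists_isPrimitiveCentralIdempotent ℚ
      (MonoidAlgebra.mapRingHom G (algebraMap ℚ F)) he.ne_zero
    obtain ⟨P, hP, rfl⟩ := hX f hf
    exact ⟨P, hP, P.exists_eq_eC he hne⟩
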